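/- Let $\rho>0$, $\theta>0$, $\gamma\ge 0$ and, for each $N$, consider the Moran model for bacterial genomes with horizontal gene transfer with $N$ individuals: the state at time $t$ is $(\mathcal G_1^N(t),\dots,\mathcal G_N^N(t))$, where each accessory genome $\mathcal G_i^N(t)$ is a finite subset of $[0,1]$, and the state evolves as a continuous-time Markov jump process with the following independent events. - Resampling: each ordered pair $(i,j)$ has a resampling event at rate $1$; then one of $i,j$ is chosen with probability $\tfrac12$ each and its offspring, carrying the genes of its parent, replaces $j$ (so an offspring of $i$ replaces $j$ at rate $\tfrac12$). - Gene loss: each gene of each individual is lost from that individual at rate $\rho/2$. - Gene gain: each individual gains, at rate $\theta/2$, a gene $U$ chosen uniformly from $[0,1]$. - Horizontal gene transfer: for each ordered pair $(i,j)$ and each gene $u$ of $i$, at rate $\gamma/(2N)$ the gene $u$ is added to the genome of $j$ (no effect if $j$ already carries $u$). Let $\mathcal G_1^N,\dots,\mathcal G_n^N$ be the genomes of the first $n$ individuals ($1\le n\le N$) when this process is in equilibrium (stationary), and put $$A^{(n,N)}=\frac1n\sum_{i=1}^n|\mathcal G_i^N|,\qquad D^{(n,N)}=\frac1{n(n-1)}\sum_{1\le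 i\ne j\le n}|\mathcal G_i^N\setminus\mathcal G_j^N|\ \ (n\ge2),\qquad G^{(n,N)}=\Big|\bigcup_{i=1}^n\mathcal G_i^N\Big|.$$ Write $(a)_{\bar m}=a(a+1)\cdots(a+m-1)$. Then these variables are integrable, the series below converge, and for fixed $n\ge1$ (with $n\ge2$ in the second line), as $N\to\infty$, $$\mathbb E[A^{(n,N)}]\longrightarrow\frac{\theta}{\rho}\Big(1+\sum_{m=1}^\infty\frac{\gamma^m}{(1+\rho)_{\bar m}}\Big),$$ $$\mathbb E[D^{(n,N)}]\longrightarrow\frac{\theta}{1+\rho}\Big(1+\sum_{m=1}^\infty\frac{\gamma^m}{(2+\rho)_{\bar m}}\Big),$$ $$\mathbb E[G^{(n,N)}]\longrightarrow\theta\sum_{k=0}^{n-1}\frac1{k+\rho}+\theta\sum_{m=1}^\infty\frac{\gamma^m}{m}\Big(\frac1{(\rho)_{\bar m}}-\frac1{(n+\rho)_{\bar m}}\Big).$$ -/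

import Mathlib

open MeasureTheory Filter Topology
open scoped NNReal

noncomputable section

namespace InfinitelyManyGenes

/-- The accessory genome of one individual: a finite set of genes from the set `[0, 1]` of
conceivable genes (a finite simple counting measure, identified with its set of atoms).
This is not a bare `Finset` because the σ-algebra that Mathlib puts on `Finset`, generated by the
events `u ∈ g`, is too small for random point configurations. -/
@[ext]
structure Genome where
  genes : Finset unitInterval

/-- The usual σ-algebra on finite point configurations: the smallest one that makes
all counts `g ↦ |g ∩ B|`, with `B ⊆ [0, 1]` Borel, measurable. -/
instance : MeasurableSpace Genome :=
  ⨆ B : {B : Set unitInterval // MeasurableSet B},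
    MeasurableSpace.comap (fun g : Genome => ((g.genes : Set unitInterval) ∩ B.1).ncard) ⊤

/-- A population of `N` individuals, each with its accessory genome. -/
abbrev Population (N : ℕ) : Type := Fin N → Genome

/-- The population after the genome of individual `j` has been replaced by the genes in `g`. -/
def replace {N : ℕ} (x : Population N) (j : Fin N) (g : Finset unitInterval) : Population N :=
  Function.update x j ⟨g⟩

/-- The generator of the Moran model with horizontal gene transfer. The four terms are:

* resampling: each ordered pair `(i, j)` has a resampling event at rate `1`; one of the two
  individuals is chosen with probability `1/2` each, and its offspring replaces `j`
  (the choice of `j` itself changes nothing, so an offspring of `i` replaces `j` at rate `1/2`);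
* gene loss: each gene of each individual is lost at rate `ρ / 2`;
* gene gain: each individual gains a gene, uniform on `[0, 1]`, at rate `θ / 2`;
* horizontal gene transfer: for each ordered pair `(i, j)`, each gene of the donor `i` is
  transferred to the acceptor `j` at rate `γ / (2 N)`.

Terms with `i = j` vanish in the first and the last sum. -/
def generator (θ ρ γ : ℝ) {N : ℕ} (f : Population N → ℝ) (x : Population N) : ℝ :=
  (∑ i : Fin N, ∑ j : Fin N, (1 / 2) * (f (replace x j (x i).genes) - f x))
  + (∑ i : Fin N, ∑ u ∈ (x i).genes, (ρ / 2) * (f (replace x i ((x i).genes.erase u)) - f x))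
  + (∑ i : Fin N, (θ / 2) * ∫ u : unitInterval, (f (replace x i (insert u (x i).genes)) - f x))
  + (∑ i : Fin N, ∑ j : Fin N, ∑ u ∈ (x i).genes,
      (γ / (2 * (N : ℝ))) * (f (replace x j (insert u (x j).genes)) - f x))

/-- `X` is a Moran model with horizontal gene transfer (gain rate `θ`, loss rate `ρ`, transfer
rate `γ`) of size `N`: a pure jump process (each path is a right-continuous step function with
finitely many jumps in bounded time) that solves the martingale problem for the generator,
with all bounded measurable `f` with bounded `generator f` as test functions. -/
structure IsMoranModel (θ ρ γ : ℝ) {N : ℕ} {Ω : Type*} [mΩ : MeasurableSpace Ω]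
    (P : Measure Ω) (X : ℝ≥0 → Ω → Population N) : Prop where
  measurable : Measurable (fun p : ℝ≥0 × Ω => X p.1 p.2)
  right_continuous : ∀ ω t, ∀ᶠ s in 𝓝[≥] t, X s ω = X t ω
  left_limit : ∀ ω t, ∃ y, ∀ᶠ s in 𝓝[<] t, X s ω = y
  martingale_problem : ∃ ℱ : Filtration ℝ≥0 mΩ, (∀ t, Measurable[ℱ t] (X t)) ∧
    ∀ f : Population N → ℝ, Measurable f → (∃ C, ∀ x, |f x| ≤ C) →
      (∃ C, ∀ x, |generator θ ρ γ f x| ≤ C) →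
      Martingale (fun (t : ℝ≥0) (ω : Ω) =>
        f (X t ω) - ∫ s in (0 : ℝ)..t, generator θ ρ γ f (X s.toNNReal ω)) ℱ P

/-- The process is in equilibrium: its law at time `t` does not depend on `t`. -/
def IsInEquilibrium {N : ℕ} {Ω : Type*} [MeasurableSpace Ω]
    (P : Measure Ω) (X : ℝ≥0 → Ω → Population N) : Prop :=
  ∀ t, P.map (X t) = P.map (X 0)

/-- The sample of the first `n` individuals of a population of size `N ≥ n`
(padded with empty genomes if `N < n`). -/
def sample (n : ℕ) {N : ℕ} (x : Population N) : Fin n → Finset unitInterval :=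
  fun i => if h : (i : ℕ) < N then (x ⟨i, h⟩).genes else ∅

/-- Average number of accessory genes per individual. -/
def averageGenes {n : ℕ} (g : Fin n → Finset unitInterval) : ℝ :=
  (1 / (n : ℝ)) * ∑ i : Fin n, ((g i).card : ℝ)

/-- Average number of pairwise differences. -/
def pairwiseDifferences {n : ℕ} (g : Fin n → Finset unitInterval) : ℝ :=
  (1 / ((n : ℝ) * ((n : ℝ) - 1))) *
    ∑ i : Fin n, ∑ j ∈ Finset.univ.filter (fun j => j ≠ i), ((g i \ g j).card : ℝ)

/-- Size of the accessory genome of the sample. -/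
def accessoryGenomeSize {n : ℕ} (g : Fin n → Finset unitInterval) : ℝ :=
  ((Finset.univ.biUnion g).card : ℝ)

/-- Rising factorial `a (a + 1) ⋯ (a + m - 1)`. -/
def rising (a : ℝ) (m : ℕ) : ℝ := (ascPochhammer ℝ m).eval a

end InfinitelyManyGenes

end

noncomputable section

namespace InfinitelyManyGenes

/-! ### Carrier sets of genes and sums over genes -/

section Carriers

variable {N : ℕ}

/-! Apart from the arrival of new genes, the carrier set of one gene is itself a Markov chain on
subsets of the population, with generator `carrierGenerator`. New genes are almost surely distinct
from those present and start with one carrier. For a function φ of carrier sets with φ(∅) = 0, the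
model's generator therefore sends the sum of φ over all genes to the sum of Lφ plus the constant
(θ/2) ∑ φ({i}) (`generatorCarrierSum_id`). In equilibrium this gives E ∑ Lφ = -(θ/2) ∑ φ({i})
(`integral_carrierSum_carrierGenerator`). Carrier sums are unbounded, so they are truncated first; a
Lyapunov function bounds the mean number of genes (`integrable_card_pangenome`) and justifies
removing the truncation.

The rates are reversible: the explicit weights `carrierWeight` satisfy detailed balance, hence the
same equation. A maximum principle makes Lφ = ψ solvable (`exists_carrierGenerator_eq`), so the
equation determines all means, and E ∑ ψ is the weighted sum of ψ (`integral_carrierSum`).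

Each statistic is a combination of numbers of genes of one individual absent from `l` others. The
mean of such a number is a binomial sum, which `sum_descFactorial_div_prod` turns into a polynomial
in γ/N; dominated convergence gives the limit θ ∑ γ^m / (ρ+l)_{m+1}, with a rising factorial. The
average uses l = 0, the differences l = 1. For the total, each gene is credited to its first carrier
in the sample, so l runs over 0, …, n-1 and the sum telescopes. -/

/-- The set of individuals that carry the gene `u`. -/
def carriers (x : Population N) (u : unitInterval) : Finset (Fin N) :=
  Finset.univ.filter fun i => u ∈ (x i).genes

/-- The set of all genes that are present in the population. -/
def pangenome (x : Population N) : Finset unitInterval :=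
  Finset.univ.biUnion fun i => (x i).genes

/-- The sum over all genes present of a function `φ` of their sets of carriers. -/
def carrierSum (φ : Finset (Fin N) → ℝ) (x : Population N) : ℝ :=
  ∑ u ∈ pangenome x, φ (carriers x u)

@[simp] lemma mem_carriers {x : Population N} {u : unitInterval} {i : Fin N} :
    i ∈ carriers x u ↔ u ∈ (x i).genes := by
  simp [carriers]

lemma mem_pangenome {x : Population N} {u : unitInterval} :
    u ∈ pangenome x ↔ ∃ i, u ∈ (x i).genes := by
  simp [pangenome]

lemma carriers_nonempty {x : Population N} {u : unitInterval} :
    (carriers x u).Nonempty ↔ u ∈ pangenome x := by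
  simp [mem_pangenome, Finset.Nonempty]

lemma carriers_eq_empty {x : Population N} {u : unitInterval} (h : u ∉ pangenome x) :
    carriers x u = ∅ := by
  rw [← Finset.not_nonempty_iff_eq_empty, carriers_nonempty]; exact h

lemma carrierSum_eq_sum {φ : Finset (Fin N) → ℝ} (hφ : φ ∅ = 0) {x : Population N}
    {V : Finset unitInterval} (hV : pangenome x ⊆ V) :
    carrierSum φ x = ∑ u ∈ V, φ (carriers x u) :=
  Finset.sum_subset hV fun u _ hu => by rw [carriers_eq_empty hu, hφ]

lemma carrierSum_add (φ ψ : Finset (Fin N) → ℝ) (x : Population N) :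
    carrierSum (fun S => φ S + ψ S) x = carrierSum φ x + carrierSum ψ x :=
  Finset.sum_add_distrib

lemma carrierSum_sub (φ ψ : Finset (Fin N) → ℝ) (x : Population N) :
    carrierSum (fun S => φ S - ψ S) x = carrierSum φ x - carrierSum ψ x :=
  Finset.sum_sub_distrib ..

lemma carrierSum_const_mul (a : ℝ) (φ : Finset (Fin N) → ℝ) (x : Population N) :
    carrierSum (fun S => a * φ S) x = a * carrierSum φ x :=
  (Finset.mul_sum ..).symm

lemma carrierSum_sum {ι : Type*} (s : Finset ι) (φ : ι → Finset (Fin N) → ℝ)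
    (x : Population N) :
    carrierSum (fun S => ∑ i ∈ s, φ i S) x = ∑ i ∈ s, carrierSum (φ i) x :=
  Finset.sum_comm

lemma carrierSum_le {φ ψ : Finset (Fin N) → ℝ} (h : ∀ S, S.Nonempty → φ S ≤ ψ S)
    (x : Population N) : carrierSum φ x ≤ carrierSum ψ x :=
  Finset.sum_le_sum fun _ hu => h _ (carriers_nonempty.2 hu)

lemma carrierSum_congr {φ ψ : Finset (Fin N) → ℝ} (h : ∀ S, S.Nonempty → φ S = ψ S)
    (x : Population N) : carrierSum φ x = carrierSum ψ x :=
  Finset.sum_congr rfl fun _ hu => h _ (carriers_nonempty.2 hu)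

lemma carrierSum_const (a : ℝ) (x : Population N) :
    carrierSum (fun _ => a) x = a * (pangenome x).card := by
  simp [carrierSum, mul_comm]

lemma abs_carrierSum_le {φ : Finset (Fin N) → ℝ} {a : ℝ} (h : ∀ S, S.Nonempty → |φ S| ≤ a)
    (x : Population N) : |carrierSum φ x| ≤ a * (pangenome x).card := by
  rw [← carrierSum_const]
  exact (Finset.abs_sum_le_sum_abs _ _).trans
    (Finset.sum_le_sum fun _ hu => h _ (carriers_nonempty.2 hu))

lemma carrierSum_ite_mem (φ : Finset (Fin N) → ℝ) (i : Fin N) (x : Population N) :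
    carrierSum (fun S => if i ∈ S then φ S else 0) x = ∑ u ∈ (x i).genes, φ (carriers x u) := by
  unfold carrierSum
  rw [← Finset.sum_filter]
  refine Finset.sum_congr ?_ fun _ _ => rfl
  ext u
  simp only [Finset.mem_filter, mem_carriers, mem_pangenome, and_iff_right_iff_imp]
  exact fun h => ⟨i, h⟩

/-- Decomposition of a sum over genes according to the set of carriers. -/
lemma carrierSum_eq_sum_single (φ : Finset (Fin N) → ℝ) (x : Population N) :
    carrierSum φ x = ∑ T, φ T * carrierSum (fun S => if S = T then 1 else 0) x := by
  simp_rw [← carrierSum_const_mul, ← carrierSum_sum]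
  exact carrierSum_congr (fun S _ => by simp) x

/-! ### Measurability -/

lemma measurableSet_exists_gene {B : Set unitInterval} (hB : MeasurableSet B) :
    MeasurableSet {g : Genome | ∃ u ∈ g.genes, u ∈ B} := by
  have h : Measurable fun g : Genome => ((g.genes : Set unitInterval) ∩ B).ncard := by
    rw [measurable_iff_comap_le]
    exact le_iSup (fun B : {B : Set unitInterval // MeasurableSet B} =>
      MeasurableSpace.comap (fun g : Genome => ((g.genes : Set unitInterval) ∩ B.1).ncard) ⊤)
      ⟨B, hB⟩
  have h2 := h (measurableSet_singleton 0).compl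
  convert h2 using 1
  ext g
  have hf : ((g.genes : Set unitInterval) ∩ B).Finite := g.genes.finite_toSet.inter_of_left _
  simp only [Set.mem_ofPred_eq, Set.mem_preimage, Set.mem_compl_iff, Set.mem_singleton_iff,
    Set.ncard_eq_zero hf, ← Set.nonempty_iff_ne_empty]
  rfl

/-- The cell of `u` in the partition of the unit interval into intervals of length `1 / m`. -/
def cell (m : ℕ) (u : unitInterval) : ℕ := ⌊(u : ℝ) * m⌋₊

lemma measurable_cell (m : ℕ) : Measurable (cell m) :=
  Nat.measurable_floor.comp (measurable_subtype_coe.mul_const _)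

lemma cell_mem_range (m : ℕ) (u : unitInterval) : cell m u ∈ Finset.range (m + 1) := by
  rw [Finset.mem_range, Nat.lt_succ_iff]
  refine Nat.floor_le_of_le ?_
  nlinarith [u.2.2, u.2.1, (Nat.cast_nonneg m : (0 : ℝ) ≤ m)]

lemma eventually_cell_ne {u v : unitInterval} (h : u ≠ v) :
    ∀ᶠ m : ℕ in atTop, cell m u ≠ cell m v := by
  have hd : 0 < |(u : ℝ) - v| := abs_pos.2 (sub_ne_zero.2 fun h' => h (Subtype.ext h'))
  have ht : Tendsto (fun m : ℕ => |(u : ℝ) - v| * (m : ℝ)) atTop atTop :=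
    tendsto_natCast_atTop_atTop.const_mul_atTop hd
  filter_upwards [ht.eventually_ge_atTop 1] with m hm he
  have hu := Nat.floor_le (mul_nonneg u.2.1 (Nat.cast_nonneg m))
  have hv := Nat.floor_le (mul_nonneg v.2.1 (Nat.cast_nonneg m))
  have hu' := Nat.lt_floor_add_one ((u : ℝ) * m)
  have hv' := Nat.lt_floor_add_one ((v : ℝ) * m)
  unfold cell at he
  rw [he] at hu hu'
  have : |((u : ℝ) - v) * m| < 1 := by rw [abs_lt]; constructor <;> linarith
  rw [abs_mul, Nat.abs_cast] at this
  linarith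

lemma eventually_cell_injOn (V : Finset unitInterval) :
    ∀ᶠ m : ℕ in atTop, Set.InjOn (cell m) V := by
  have : ∀ᶠ m : ℕ in atTop, ∀ u ∈ V, ∀ v ∈ V, u ≠ v → cell m u ≠ cell m v := by
    rw [Filter.eventually_all_finset]
    intro u _
    rw [Filter.eventually_all_finset]
    intro v _
    by_cases h : u = v
    · simp [h]
    · filter_upwards [eventually_cell_ne h] with m hm _ using hm
  filter_upwards [this] with m hm u hu v hv
  contrapose!
  exact hm u hu v hv

/-- The individuals that carry a gene in a given cell. -/
def cellCarriers (m k : ℕ) (x : Population N) : Finset (Fin N) :=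
  Finset.univ.filter fun i => ∃ u ∈ (x i).genes, cell m u = k

lemma measurableSet_cellCarriers_eq (m k : ℕ) (T : Finset (Fin N)) :
    MeasurableSet {x : Population N | cellCarriers m k x = T} := by
  have : {x : Population N | cellCarriers m k x = T} =
      ⋂ i, {x : Population N | (∃ u ∈ (x i).genes, cell m u = k) ↔ i ∈ T} := by
    ext x; simp [cellCarriers, Finset.ext_iff]
  rw [this]
  refine MeasurableSet.iInter fun i => ?_
  have h : MeasurableSet {x : Population N | ∃ u ∈ (x i).genes, cell m u = k} := by
    simpa using measurableSet_preimage (measurable_pi_apply (X := fun _ : Fin N => Genome) i)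
      (measurableSet_exists_gene (measurable_cell m (measurableSet_singleton k)))
  by_cases hi : i ∈ T
  · simpa [hi] using h
  · simpa only [hi, iff_false, Set.compl_ofPred] using h.compl

lemma measurable_comp_cellCarriers (φ : Finset (Fin N) → ℝ) (m k : ℕ) :
    Measurable fun x : Population N => φ (cellCarriers m k x) := by
  have : (fun x : Population N => φ (cellCarriers m k x)) =
      fun x => ∑ T, {x : Population N | cellCarriers m k x = T}.indicator (fun _ => φ T) x := by
    ext x; simp [Set.indicator_apply]
  rw [this]
  exact Finset.measurable_sum _ fun T _ =>
    measurable_const.indicator (measurableSet_cellCarriers_eq m k T)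

/-- Once the partition separates the genes, an occupied cell has the carriers of its only gene, and
an empty cell contributes φ(∅) = 0. -/
lemma sum_cellCarriers {φ : Finset (Fin N) → ℝ} (hφ : φ ∅ = 0) {m : ℕ} {x : Population N}
    (h : Set.InjOn (cell m) (pangenome x)) :
    ∑ k ∈ Finset.range (m + 1), φ (cellCarriers m k x) = carrierSum φ x := by
  have himg : (pangenome x).image (cell m) ⊆ Finset.range (m + 1) := by
    intro k hk
    obtain ⟨u, -, rfl⟩ := Finset.mem_image.1 hk
    exact cell_mem_range m u
  rw [← Finset.sum_subset himg, Finset.sum_image h]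
  · refine Finset.sum_congr rfl fun u hu => congrArg φ ?_
    ext i
    simp only [cellCarriers, Finset.mem_filter, Finset.mem_univ, true_and, mem_carriers]
    constructor
    · rintro ⟨v, hv, hvu⟩
      rwa [← h (mem_pangenome.2 ⟨i, hv⟩) hu hvu]
    · exact fun hu => ⟨u, hu, rfl⟩
  · intro k _ hk
    convert hφ
    refine Finset.filter_eq_empty_iff.2 fun i _ => ?_
    rintro ⟨u, hu, rfl⟩
    exact hk (Finset.mem_image_of_mem _ (mem_pangenome.2 ⟨i, hu⟩))

/-- The σ-algebra on genomes sees only counts in Borel sets, so genes are located through ever finer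
cells; for each population the approximation is eventually exact. -/
lemma measurable_carrierSum_of_zero {φ : Finset (Fin N) → ℝ} (hφ : φ ∅ = 0) :
    Measurable (carrierSum φ) := by
  refine measurable_of_tendsto_metrizable
    (f := fun m (x : Population N) => ∑ k ∈ Finset.range (m + 1), φ (cellCarriers m k x))
    (fun m => Finset.measurable_sum _ fun k _ => measurable_comp_cellCarriers φ m k) ?_
  rw [tendsto_pi_nhds]
  intro x
  refine tendsto_const_nhds.congr' ?_
  filter_upwards [eventually_cell_injOn (pangenome x)] with m hm
  exact (sum_cellCarriers hφ hm).symm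

lemma measurable_carrierSum (φ : Finset (Fin N) → ℝ) : Measurable (carrierSum φ) := by
  have : carrierSum φ = carrierSum fun S => if S = ∅ then 0 else φ S := by
    ext x
    exact carrierSum_congr (fun S hS => by simp [hS.ne_empty]) x
  rw [this]
  exact measurable_carrierSum_of_zero (by simp)

lemma measurable_card_pangenome :
    Measurable fun x : Population N => ((pangenome x).card : ℝ) := by
  have h : (fun x : Population N => ((pangenome x).card : ℝ)) = carrierSum fun _ => 1 := by
    ext x; rw [carrierSum_const, one_mul]
  rw [h]
  exact measurable_carrierSum _

/-! ### Stationarity -/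

section Stationary

variable {θ ρ γ : ℝ} {Ω : Type*} [MeasurableSpace Ω] {P : Measure Ω}
  {X : ℝ≥0 → Ω → Population N}

lemma IsMoranModel.measurable_apply (hX : IsMoranModel θ ρ γ P X) (t : ℝ≥0) :
    Measurable (X t) :=
  hX.measurable.comp measurable_prodMk_left

lemma IsInEquilibrium.integral_comp_eq (hX : IsMoranModel θ ρ γ P X) (hEq : IsInEquilibrium P X)
    {f : Population N → ℝ} (hf : Measurable f) (t : ℝ≥0) :
    ∫ ω, f (X t ω) ∂P = ∫ ω, f (X 0 ω) ∂P := by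
  rw [← integral_map (hX.measurable_apply t).aemeasurable hf.aestronglyMeasurable, hEq t,
    integral_map (hX.measurable_apply 0).aemeasurable hf.aestronglyMeasurable]

/-- In equilibrium, the generator of a bounded test function has mean zero. -/
lemma integral_generator_eq_zero [IsProbabilityMeasure P] (hX : IsMoranModel θ ρ γ P X) (hEq : IsInEquilibrium P X)
    {f : Population N → ℝ} (hf : Measurable f) (hb : ∃ C, ∀ x, |f x| ≤ C)
    (hg : Measurable (generator θ ρ γ f)) (hgb : ∃ C, ∀ x, |generator θ ρ γ f x| ≤ C) :
    ∫ ω, generator θ ρ γ f (X 0 ω) ∂P = 0 := by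
  obtain ⟨ℱ, -, hM⟩ := hX.martingale_problem
  have hm := hM f hf hb hgb
  obtain ⟨C, hC⟩ := hb
  obtain ⟨D, hD⟩ := hgb
  have hfi (t : ℝ≥0) : Integrable (fun ω => f (X t ω)) P :=
    Integrable.of_bound (hf.comp (hX.measurable_apply t)).aestronglyMeasurable C
      (.of_forall fun ω => hC _)
  -- The martingale has equal means at times 0 and 1. Stationarity cancels the means of `f`, and
  -- after Fubini the time integral is the constant mean of the generator.
  have h1 := hm.setIntegral_eq (zero_le_one : (0 : ℝ≥0) ≤ 1) MeasurableSet.univ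
  simp only [setIntegral_univ, NNReal.coe_zero, intervalIntegral.integral_same, sub_zero,
    NNReal.coe_one] at h1
  have hI : Integrable (fun ω => ∫ s in (0 : ℝ)..1, generator θ ρ γ f (X s.toNNReal ω)) P := by
    have := (hfi 1).sub (hm.integrable 1)
    refine this.congr (.of_forall fun ω => ?_)
    simp
  rw [integral_sub (hfi 1) hI, hEq.integral_comp_eq hX hf 1] at h1
  have h2 : ∫ ω, (∫ s in (0 : ℝ)..1, generator θ ρ γ f (X s.toNNReal ω)) ∂P = 0 := by linarith
  simp_rw [intervalIntegral.integral_of_le (zero_le_one : (0 : ℝ) ≤ 1)] at h2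
  rw [integral_integral_swap] at h2
  · have h3 (s : ℝ) : ∫ ω, generator θ ρ γ f (X s.toNNReal ω) ∂P
        = ∫ ω, generator θ ρ γ f (X 0 ω) ∂P := hEq.integral_comp_eq hX hg _
    simpa [h3] using h2
  · refine Integrable.of_bound (Measurable.aestronglyMeasurable ?_) D (.of_forall fun p => hD _)
    have : Measurable fun p : Ω × ℝ => (p.2.toNNReal, p.1) := by fun_prop
    exact hg.comp (hX.measurable.comp this)

end Stationary

/-! ### The generator on functions of the carrier sum -/

/-- The carriers of a gene with carriers `S` after an offspring of `i` has replaced `j`. -/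
def resample (i j : Fin N) (S : Finset (Fin N)) : Finset (Fin N) :=
  if i ∈ S then insert j S else S.erase j

lemma mem_replace {x : Population N} {i j : Fin N} {g : Finset unitInterval} {u : unitInterval} :
    u ∈ (replace x j g i).genes ↔ if i = j then u ∈ g else u ∈ (x i).genes := by
  unfold replace
  by_cases h : i = j
  · subst h; simp
  · simp [h]

lemma pangenome_replace_subset (x : Population N) (j : Fin N) (g : Finset unitInterval) :
    pangenome (replace x j g) ⊆ pangenome x ∪ g := by
  intro u hu
  obtain ⟨i, hi⟩ := mem_pangenome.1 hu
  rw [mem_replace] at hi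
  rw [Finset.mem_union]
  split_ifs at hi
  · exact .inr hi
  · exact .inl (mem_pangenome.2 ⟨i, hi⟩)

lemma genes_subset_pangenome (x : Population N) (i : Fin N) : (x i).genes ⊆ pangenome x :=
  fun _ hu => mem_pangenome.2 ⟨i, hu⟩

lemma carriers_resample (x : Population N) (i j : Fin N) (u : unitInterval) :
    carriers (replace x j (x i).genes) u = resample i j (carriers x u) := by
  ext k
  simp only [mem_carriers, mem_replace, resample]
  split_ifs with h1 h2 h2 <;> simp_all

/-- Replacement can only make genes disappear, and φ(∅) = 0 lets the sum keep running over the old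
genes. -/
lemma carrierSum_resample {φ : Finset (Fin N) → ℝ} (hφ : φ ∅ = 0) (x : Population N)
    (i j : Fin N) :
    carrierSum φ (replace x j (x i).genes) = carrierSum (fun S => φ (resample i j S)) x := by
  have h : pangenome (replace x j (x i).genes) ⊆ pangenome x :=
    (pangenome_replace_subset ..).trans (Finset.union_subset subset_rfl
      (genes_subset_pangenome x i))
  rw [carrierSum_eq_sum hφ h]
  simp_rw [carriers_resample]
  rfl

/-- If the carriers of a single gene change, then so does one term of the carrier sum. -/
lemma carrierSum_eq_add_of_forall_ne {φ : Finset (Fin N) → ℝ} (hφ : φ ∅ = 0)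
    {x y : Population N} {u : unitInterval} (h : ∀ v, v ≠ u → carriers y v = carriers x v) :
    carrierSum φ y = carrierSum φ x + (φ (carriers y u) - φ (carriers x u)) := by
  set V := insert u (pangenome x ∪ pangenome y)
  have hu : u ∈ V := Finset.mem_insert_self ..
  rw [carrierSum_eq_sum hφ (V := V) (x := x), carrierSum_eq_sum hφ (V := V) (x := y),
    ← Finset.add_sum_erase _ _ hu, ← Finset.add_sum_erase _ _ hu,
    Finset.sum_congr rfl fun v hv => by rw [h v (Finset.ne_of_mem_erase hv)]]
  · ring
  · exact Finset.subset_union_right.trans (Finset.subset_insert ..)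
  · exact Finset.subset_union_left.trans (Finset.subset_insert ..)

lemma carrierSum_erase {φ : Finset (Fin N) → ℝ} (hφ : φ ∅ = 0) (x : Population N)
    (i : Fin N) (u : unitInterval) :
    carrierSum φ (replace x i ((x i).genes.erase u)) =
      carrierSum φ x + (φ ((carriers x u).erase i) - φ (carriers x u)) := by
  rw [carrierSum_eq_add_of_forall_ne hφ (u := u) (x := x)]
  · congr 3
    ext k
    simp only [mem_carriers, mem_replace, Finset.mem_erase]
    split_ifs <;> simp_all
  · intro v hv
    ext k
    simp only [mem_carriers, mem_replace, Finset.mem_erase]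
    split_ifs <;> simp_all

lemma carrierSum_insert {φ : Finset (Fin N) → ℝ} (hφ : φ ∅ = 0) (x : Population N)
    (j : Fin N) (u : unitInterval) :
    carrierSum φ (replace x j (insert u (x j).genes)) =
      carrierSum φ x + (φ (insert j (carriers x u)) - φ (carriers x u)) := by
  rw [carrierSum_eq_add_of_forall_ne hφ (u := u) (x := x)]
  · congr 3
    ext k
    simp only [mem_carriers, mem_replace, Finset.mem_insert]
    split_ifs <;> simp_all
  · intro v hv
    ext k
    simp only [mem_carriers, mem_replace, Finset.mem_insert]
    split_ifs <;> simp_all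

lemma ae_notMem_finset (V : Finset unitInterval) : ∀ᵐ u : unitInterval, u ∉ V := by
  have := V.finite_toSet.measure_zero (volume : Measure unitInterval)
  simpa using measure_eq_zero_iff_ae_notMem.1 this

/-- The generator on functions of the form `x ↦ g (carrierSum φ x)`, written as a function of
finitely many carrier sums. -/
def generatorCarrierSum (θ ρ γ : ℝ) (g : ℝ → ℝ) (φ : Finset (Fin N) → ℝ) (x : Population N) : ℝ :=
  (∑ i : Fin N, ∑ j : Fin N,
    (1 / 2) * (g (carrierSum (fun S => φ (resample i j S)) x) - g (carrierSum φ x)))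
  + (∑ i : Fin N, carrierSum (fun S => if i ∈ S then
      (ρ / 2) * (g (carrierSum φ x + (φ (S.erase i) - φ S)) - g (carrierSum φ x)) else 0) x)
  + (∑ i : Fin N, (θ / 2) * (g (carrierSum φ x + φ {i}) - g (carrierSum φ x)))
  + (∑ i : Fin N, ∑ j : Fin N, carrierSum (fun S => if i ∈ S then
      (γ / (2 * (N : ℝ))) * (g (carrierSum φ x + (φ (insert j S) - φ S)) - g (carrierSum φ x))
      else 0) x)

lemma generator_comp_carrierSum (θ ρ γ : ℝ) (g : ℝ → ℝ) {φ : Finset (Fin N) → ℝ}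
    (hφ : φ ∅ = 0) (x : Population N) :
    generator θ ρ γ (fun x => g (carrierSum φ x)) x = generatorCarrierSum θ ρ γ g φ x := by
  unfold generator generatorCarrierSum
  congr 1
  · congr 1
    · congr 1
      · simp_rw [carrierSum_resample hφ]
      · refine Finset.sum_congr rfl fun i _ => ?_
        rw [carrierSum_ite_mem (fun S =>
          (ρ / 2) * (g (carrierSum φ x + (φ (S.erase i) - φ S)) - g (carrierSum φ x)))]
        simp_rw [carrierSum_erase hφ]
    · refine Finset.sum_congr rfl fun i _ => ?_
      congr 1
      -- Almost surely the gained gene is new, so its carrier set changes from ∅ to {i}.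
      have : ∀ᵐ u : unitInterval, g (carrierSum φ (replace x i (insert u (x i).genes)))
          - g (carrierSum φ x) = g (carrierSum φ x + φ {i}) - g (carrierSum φ x) := by
        filter_upwards [ae_notMem_finset (pangenome x)] with u hu
        rw [carrierSum_insert hφ, carriers_eq_empty hu, hφ]
        simp
      rw [integral_congr_ae this]
      simp
  · refine Finset.sum_congr rfl fun i _ => Finset.sum_congr rfl fun j _ => ?_
    rw [carrierSum_ite_mem (fun S => (γ / (2 * (N : ℝ))) *
      (g (carrierSum φ x + (φ (insert j S) - φ S)) - g (carrierSum φ x)))]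
    simp_rw [carrierSum_insert hφ]

/-- Needed because in `generatorCarrierSum` the summands depend on the population through its total
carrier sum. -/
lemma measurable_carrierSum_dep {K : Finset (Fin N) → Population N → ℝ}
    (hK : ∀ S, Measurable (K S)) : Measurable fun x => carrierSum (fun S => K S x) x := by
  have : (fun x => carrierSum (fun S => K S x) x) =
      fun x => ∑ T, K T x * carrierSum (fun S => if S = T then 1 else 0) x := by
    ext x; exact carrierSum_eq_sum_single _ x
  rw [this]
  exact Finset.measurable_sum _ fun T _ => (hK T).mul (measurable_carrierSum _)

lemma measurable_generatorCarrierSum (θ ρ γ : ℝ) {g : ℝ → ℝ} (hg : Measurable g)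
    (φ : Finset (Fin N) → ℝ) : Measurable (generatorCarrierSum θ ρ γ g φ) := by
  have hH := measurable_carrierSum φ
  unfold generatorCarrierSum
  refine Measurable.add (Measurable.add (Measurable.add ?_ ?_) ?_) ?_
  · refine Finset.measurable_sum _ fun i _ => Finset.measurable_sum _ fun j _ => ?_
    exact ((hg.comp (measurable_carrierSum _)).sub (hg.comp hH)).const_mul _
  · refine Finset.measurable_sum _ fun i _ => measurable_carrierSum_dep fun S => ?_
    split_ifs
    · exact ((hg.comp (hH.add_const _)).sub (hg.comp hH)).const_mul _
    · exact measurable_const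
  · refine Finset.measurable_sum _ fun i _ => ?_
    exact ((hg.comp (hH.add_const _)).sub (hg.comp hH)).const_mul _
  · refine Finset.measurable_sum _ fun i _ => Finset.measurable_sum _ fun j _ =>
      measurable_carrierSum_dep fun S => ?_
    split_ifs
    · exact ((hg.comp (hH.add_const _)).sub (hg.comp hH)).const_mul _
    · exact measurable_const

/-! ### The set of carriers of a single gene as a Markov chain -/

/-- The rate at which a given non-carrier of a gene with `k` carriers becomes a carrier. -/
def gainRate (N : ℕ) (γ : ℝ) (k : ℕ) : ℝ := k * (1 / 2 + γ / (2 * N))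

/-- The rate at which a given carrier of a gene with `k` carriers ceases to be a carrier. -/
def lossRate (N : ℕ) (ρ : ℝ) (k : ℕ) : ℝ := ((N : ℝ) - k + ρ) / 2

/-- The generator of the set of carriers of a single gene. -/
def carrierGenerator (ρ γ : ℝ) (φ : Finset (Fin N) → ℝ) (S : Finset (Fin N)) : ℝ :=
  ∑ j ∈ Sᶜ, gainRate N γ S.card * (φ (insert j S) - φ S)
  + ∑ j ∈ S, lossRate N ρ S.card * (φ (S.erase j) - φ S)

@[simp] lemma carrierGenerator_empty (ρ γ : ℝ) (φ : Finset (Fin N) → ℝ) :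
    carrierGenerator ρ γ φ ∅ = 0 := by
  simp [carrierGenerator, gainRate]

lemma gainRate_nonneg {γ : ℝ} (hγ : 0 ≤ γ) (k : ℕ) : 0 ≤ gainRate N γ k := by
  unfold gainRate; positivity

lemma lossRate_nonneg {ρ : ℝ} (hρ : 0 < ρ) (S : Finset (Fin N)) : 0 ≤ lossRate N ρ S.card := by
  have : (S.card : ℝ) ≤ N := by exact_mod_cast card_finset_fin_le S
  unfold lossRate
  linarith

/-- A non-carrier changes status only if replaced by one of the |S| carriers, a carrier only if
replaced by one of the N - |S| non-carriers. -/
lemma sum_resample (φ : Finset (Fin N) → ℝ) (S : Finset (Fin N)) :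
    ∑ i, ∑ j, (1 / 2) * (φ (resample i j S) - φ S) =
      ∑ j ∈ Sᶜ, ((S.card : ℝ) / 2) * (φ (insert j S) - φ S)
      + ∑ j ∈ S, (((N : ℝ) - S.card) / 2) * (φ (S.erase j) - φ S) := by
  have hc : ((Sᶜ.card : ℕ) : ℝ) = (N : ℝ) - S.card := by
    rw [Finset.card_compl, Fintype.card_fin, Nat.cast_sub (card_finset_fin_le S)]
  rw [Finset.sum_comm, ← Finset.sum_add_sum_compl S, add_comm]
  congr 1
  · refine Finset.sum_congr rfl fun j hj => ?_
    have hj : j ∉ S := Finset.mem_compl.1 hj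
    rw [← Finset.sum_add_sum_compl S]
    have h1 : ∑ i ∈ S, (1 / 2) * (φ (resample i j S) - φ S) =
        ∑ i ∈ S, (1 / 2) * (φ (insert j S) - φ S) :=
      Finset.sum_congr rfl fun i hi => by simp [resample, hi]
    have h2 : ∑ i ∈ Sᶜ, (1 / 2) * (φ (resample i j S) - φ S) = 0 :=
      Finset.sum_eq_zero fun i hi => by
        simp [resample, Finset.mem_compl.1 hi, Finset.erase_eq_of_notMem hj]
    rw [h1, h2, Finset.sum_const, nsmul_eq_mul]
    ring
  · refine Finset.sum_congr rfl fun j hj => ?_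
    rw [← Finset.sum_add_sum_compl S]
    have h1 : ∑ i ∈ S, (1 / 2) * (φ (resample i j S) - φ S) = 0 :=
      Finset.sum_eq_zero fun i hi => by simp [resample, hi, Finset.insert_eq_of_mem hj]
    have h2 : ∑ i ∈ Sᶜ, (1 / 2) * (φ (resample i j S) - φ S) =
        ∑ i ∈ Sᶜ, (1 / 2) * (φ (S.erase j) - φ S) :=
      Finset.sum_congr rfl fun i hi => by simp [resample, Finset.mem_compl.1 hi]
    rw [h1, h2, Finset.sum_const, nsmul_eq_mul, hc]
    ring

lemma sum_transfer (γ : ℝ) (φ : Finset (Fin N) → ℝ) (S : Finset (Fin N)) :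
    (∑ i, ∑ j, if i ∈ S then (γ / (2 * (N : ℝ))) * (φ (insert j S) - φ S) else 0) =
      ∑ j ∈ Sᶜ, ((S.card : ℝ) * (γ / (2 * N))) * (φ (insert j S) - φ S) := by
  rw [Finset.sum_comm, ← Finset.sum_add_sum_compl S]
  rw [Finset.sum_eq_zero fun j hj => by simp [Finset.insert_eq_of_mem hj], zero_add]
  refine Finset.sum_congr rfl fun j _ => ?_
  rw [Finset.sum_ite_mem, Finset.univ_inter, Finset.sum_const, nsmul_eq_mul]
  ring

lemma carrierGenerator_eq (ρ γ : ℝ) (φ : Finset (Fin N) → ℝ) (S : Finset (Fin N)) :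
    carrierGenerator ρ γ φ S =
      ∑ i, ∑ j, (1 / 2) * (φ (resample i j S) - φ S)
      + (∑ i, if i ∈ S then (ρ / 2) * (φ (S.erase i) - φ S) else 0)
      + (∑ i, ∑ j, if i ∈ S then (γ / (2 * (N : ℝ))) * (φ (insert j S) - φ S) else 0) := by
  rw [sum_resample, sum_transfer, Finset.sum_ite_mem, Finset.univ_inter]
  have h1 (d : ℝ) : gainRate N γ S.card * d =
      (S.card : ℝ) / 2 * d + (S.card : ℝ) * (γ / (2 * N)) * d := by unfold gainRate; ring
  have h2 (d : ℝ) : lossRate N ρ S.card * d = ((N : ℝ) - S.card) / 2 * d + ρ / 2 * d := by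
    unfold lossRate; ring
  unfold carrierGenerator
  simp_rw [h1, h2, Finset.sum_add_distrib]
  ring

/-- For linear functionals the genes decouple: simultaneous changes at a resampling event add up
gene by gene. -/
lemma generatorCarrierSum_id (θ ρ γ : ℝ) (φ : Finset (Fin N) → ℝ) (x : Population N) :
    generatorCarrierSum θ ρ γ id φ x =
      carrierSum (carrierGenerator ρ γ φ) x + θ / 2 * ∑ i, φ {i} := by
  have h : carrierGenerator ρ γ φ = fun S => _ := funext (carrierGenerator_eq ρ γ φ)
  rw [h, carrierSum_add, carrierSum_add]
  simp_rw [carrierSum_sum, carrierSum_const_mul, carrierSum_sub]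
  unfold generatorCarrierSum
  simp only [id, add_sub_cancel_left, Finset.mul_sum]
  ring

/-- All jump rates are nonnegative, so order is preserved at a point of contact; this drives the
maximum principle. -/
lemma carrierGenerator_le_of_le {ρ γ : ℝ} (hρ : 0 < ρ) (hγ : 0 ≤ γ)
    {φ ψ : Finset (Fin N) → ℝ} {S : Finset (Fin N)} (h : ∀ T, φ T ≤ ψ T) (hS : φ S = ψ S) :
    carrierGenerator ρ γ φ S ≤ carrierGenerator ρ γ ψ S := by
  unfold carrierGenerator
  rw [hS]
  refine add_le_add (Finset.sum_le_sum fun j _ => ?_) (Finset.sum_le_sum fun j _ => ?_)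
  · exact mul_le_mul_of_nonneg_left (sub_le_sub_right (h _) _) (gainRate_nonneg hγ _)
  · exact mul_le_mul_of_nonneg_left (sub_le_sub_right (h _) _) (lossRate_nonneg hρ _)

lemma carrierGenerator_add (ρ γ : ℝ) (φ ψ : Finset (Fin N) → ℝ) (S : Finset (Fin N)) :
    carrierGenerator ρ γ (fun T => φ T + ψ T) S =
      carrierGenerator ρ γ φ S + carrierGenerator ρ γ ψ S := by
  unfold carrierGenerator
  rw [add_add_add_comm, ← Finset.sum_add_distrib, ← Finset.sum_add_distrib]
  congr 1 <;> refine Finset.sum_congr rfl fun j _ => ?_ <;> ring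

lemma carrierGenerator_const_mul (ρ γ a : ℝ) (φ : Finset (Fin N) → ℝ) (S : Finset (Fin N)) :
    carrierGenerator ρ γ (fun T => a * φ T) S = a * carrierGenerator ρ γ φ S := by
  unfold carrierGenerator
  rw [mul_add, Finset.mul_sum, Finset.mul_sum]
  congr 1 <;> refine Finset.sum_congr rfl fun j _ => ?_ <;> ring

/-! ### Lyapunov function, maximum principle and Poisson equation -/

/-- The ratio of the geometric weights in the Lyapunov function. -/
def lyapunovRatio (N : ℕ) (γ : ℝ) : ℝ := (1 + γ / N)⁻¹

/-- A Lyapunov function for the set of carriers of a single gene. -/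
def lyapunov (γ : ℝ) (S : Finset (Fin N)) : ℝ :=
  ∑ k ∈ Finset.range S.card, lyapunovRatio N γ ^ (k + 1)

lemma lyapunovRatio_pos {γ : ℝ} (hγ : 0 ≤ γ) : 0 < lyapunovRatio N γ := by
  unfold lyapunovRatio; positivity

lemma lyapunovRatio_le_one {γ : ℝ} (hγ : 0 ≤ γ) : lyapunovRatio N γ ≤ 1 :=
  inv_le_one_of_one_le₀ (by simpa using (by positivity : 0 ≤ γ / N))

@[simp] lemma lyapunov_empty (γ : ℝ) : lyapunov γ (∅ : Finset (Fin N)) = 0 := by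
  simp [lyapunov]

lemma lyapunovRatio_le_lyapunov {γ : ℝ} (hγ : 0 ≤ γ) {S : Finset (Fin N)} (hS : S.Nonempty) :
    lyapunovRatio N γ ≤ lyapunov γ S := by
  have := Finset.single_le_sum (f := fun k => lyapunovRatio N γ ^ (k + 1))
    (fun k _ => (pow_pos (lyapunovRatio_pos hγ) _).le)
    (Finset.mem_range.2 (Finset.card_pos.2 hS))
  rwa [zero_add, pow_one] at this

lemma lyapunov_pos {γ : ℝ} (hγ : 0 ≤ γ) {S : Finset (Fin N)} (hS : S.Nonempty) :
    0 < lyapunov γ S :=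
  (lyapunovRatio_pos hγ).trans_le (lyapunovRatio_le_lyapunov hγ hS)

/-- The ratio c is chosen so that (1/2 + γ/(2N)) c = 1/2: gains by resampling and transfer then
cancel the resampling losses exactly, leaving only the gene loss term. -/
lemma carrierGenerator_lyapunov (ρ : ℝ) {γ : ℝ} (hγ : 0 ≤ γ) (S : Finset (Fin N)) :
    carrierGenerator ρ γ (lyapunov γ) S =
      -(lyapunovRatio N γ ^ S.card * S.card * (ρ / 2)) := by
  set c := lyapunovRatio N γ
  have h1 : ∑ j ∈ Sᶜ, gainRate N γ S.card * (lyapunov γ (insert j S) - lyapunov γ S) =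
      ∑ j ∈ Sᶜ, gainRate N γ S.card * c ^ (S.card + 1) :=
    Finset.sum_congr rfl fun j hj => by
      rw [lyapunov, Finset.card_insert_of_notMem (Finset.mem_compl.1 hj), Finset.sum_range_succ,
        lyapunov, add_sub_cancel_left]
  have h2 : ∑ j ∈ S, lossRate N ρ S.card * (lyapunov γ (S.erase j) - lyapunov γ S) =
      ∑ j ∈ S, lossRate N ρ S.card * -c ^ S.card :=
    Finset.sum_congr rfl fun j hj => by
      rw [lyapunov, lyapunov, ← Finset.card_erase_add_one hj, Finset.sum_range_succ,
        sub_add_cancel_left]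
  unfold carrierGenerator
  rw [h1, h2, Finset.sum_const, Finset.sum_const, Finset.card_compl, Fintype.card_fin,
    nsmul_eq_mul, nsmul_eq_mul, Nat.cast_sub (card_finset_fin_le S)]
  have h3 : (1 / 2 + γ / (2 * N)) * c = 1 / 2 := by
    have : (1 + γ / N) * c = 1 := mul_inv_cancel₀ (by positivity)
    rw [mul_comm 2 (N : ℝ), ← div_div]
    linear_combination this / 2
  unfold gainRate lossRate
  linear_combination ((N : ℝ) - S.card) * S.card * c ^ S.card * h3

lemma carrierGenerator_lyapunov_le {ρ γ : ℝ} (hρ : 0 < ρ) (hγ : 0 ≤ γ) {S : Finset (Fin N)}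
    (hS : S.Nonempty) :
    carrierGenerator ρ γ (lyapunov γ) S ≤ -(lyapunovRatio N γ ^ N * (ρ / 2)) := by
  rw [carrierGenerator_lyapunov ρ hγ, neg_le_neg_iff]
  have h1 : lyapunovRatio N γ ^ N ≤ lyapunovRatio N γ ^ S.card :=
    pow_le_pow_of_le_one (lyapunovRatio_pos hγ).le (lyapunovRatio_le_one hγ)
      (card_finset_fin_le S)
  have h2 : (1 : ℝ) ≤ S.card := by exact_mod_cast Finset.card_pos.2 hS
  have h3 := (pow_pos (lyapunovRatio_pos (N := N) hγ) S.card).le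
  have : lyapunovRatio N γ ^ N * 1 ≤ lyapunovRatio N γ ^ S.card * S.card := by gcongr
  rw [mul_one] at this
  gcongr

/-- Maximum principle for the generator of the set of carriers. -/
lemma nonpos_of_carrierGenerator_nonneg {ρ γ : ℝ} (hρ : 0 < ρ) (hγ : 0 ≤ γ)
    {φ : Finset (Fin N) → ℝ} (h0 : φ ∅ = 0) (h : ∀ S, 0 ≤ carrierGenerator ρ γ φ S)
    (S : Finset (Fin N)) : φ S ≤ 0 := by
  by_contra! hS
  -- The multiple of the Lyapunov function with the maximal ratio lies above `φ` and touches it at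
  -- `T`. Its generator is negative there, contradicting `h T`.
  obtain ⟨T, -, hT⟩ := Finset.exists_max_image Finset.univ
    (fun T : Finset (Fin N) => φ T / lyapunov γ T) Finset.univ_nonempty
  have hSne : S.Nonempty := by
    rw [Finset.nonempty_iff_ne_empty]; rintro rfl; exact hS.ne' h0
  have hpos : 0 < φ T / lyapunov γ T :=
    (div_pos hS (lyapunov_pos hγ hSne)).trans_le (hT S (Finset.mem_univ _))
  have hTne : T.Nonempty := by
    -- Division by zero gives ratio 0 at ∅, so a positive maximum is attained elsewhere.
    rw [Finset.nonempty_iff_ne_empty]; rintro rfl; simp at hpos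
  have hle := carrierGenerator_le_of_le hρ hγ (S := T) (φ := φ)
    (ψ := fun R => φ T / lyapunov γ T * lyapunov γ R) (fun R => ?_)
    (div_mul_cancel₀ _ (lyapunov_pos hγ hTne).ne').symm
  · rw [carrierGenerator_const_mul] at hle
    have h1 := carrierGenerator_lyapunov_le hρ hγ hTne
    have h2 := mul_pos (pow_pos (lyapunovRatio_pos (N := N) hγ) N) (half_pos hρ)
    nlinarith [h T]
  · rcases R.eq_empty_or_nonempty with rfl | hR
    · simp [h0]
    · exact (div_le_iff₀ (lyapunov_pos hγ hR)).1 (hT R (Finset.mem_univ _))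

/-- The Poisson equation for the set of carriers of a single gene is solvable. -/
lemma exists_carrierGenerator_eq {ρ γ : ℝ} (hρ : 0 < ρ) (hγ : 0 ≤ γ)
    {ψ : Finset (Fin N) → ℝ} (hψ : ψ ∅ = 0) :
    ∃ φ : Finset (Fin N) → ℝ, φ ∅ = 0 ∧ carrierGenerator ρ γ φ = ψ := by
  -- Constants lie in the kernel of the generator, and ∅ is absorbing. Adding the value at ∅ there
  -- makes the operator injective, hence surjective in finite dimension.
  let Q : (Finset (Fin N) → ℝ) →ₗ[ℝ] (Finset (Fin N) → ℝ) :=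
    { toFun := fun φ S => carrierGenerator ρ γ φ S + if S = ∅ then φ ∅ else 0
      map_add' := fun φ χ => by
        ext S
        simp only [Pi.add_apply]
        rw [show φ + χ = fun T => φ T + χ T from rfl, carrierGenerator_add]
        split_ifs <;> ring
      map_smul' := fun a φ => by
        ext S
        simp only [Pi.smul_apply, smul_eq_mul, RingHom.id_apply]
        rw [show a • φ = fun T => a * φ T from rfl, carrierGenerator_const_mul]
        split_ifs <;> ring }
  have hQ0 (φ : Finset (Fin N) → ℝ) : Q φ ∅ = φ ∅ := by
    change carrierGenerator ρ γ φ ∅ + (if (∅ : Finset (Fin N)) = ∅ then φ ∅ else 0) = φ ∅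
    simp
  have hQ {φ : Finset (Fin N) → ℝ} (h : φ ∅ = 0) : Q φ = carrierGenerator ρ γ φ := by
    ext S
    change carrierGenerator ρ γ φ S + (if S = ∅ then φ ∅ else 0) = _
    simp [h]
  have hinj : Function.Injective Q := by
    rw [injective_iff_map_eq_zero]
    intro φ hφ
    have h0 : φ ∅ = 0 := by rw [← hQ0 φ, hφ]; rfl
    rw [hQ h0] at hφ
    ext S
    refine le_antisymm ?_ ?_
    · exact nonpos_of_carrierGenerator_nonneg hρ hγ h0 (fun S => by simp [hφ]) S
    · have := nonpos_of_carrierGenerator_nonneg hρ hγ (φ := fun T => -1 * φ T) (by simp [h0])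
        (fun S => by rw [carrierGenerator_const_mul]; simp [hφ]) S
      simpa using this
  obtain ⟨φ, hφ⟩ := LinearMap.injective_iff_surjective.1 hinj ψ
  have h0 : φ ∅ = 0 := by rw [← hQ0 φ, hφ, hψ]
  exact ⟨φ, h0, by rw [← hQ h0, hφ]⟩

/-! ### Truncation -/

lemma abs_sum_fin_le {f : Fin N → ℝ} {B : ℝ} (h : ∀ i, |f i| ≤ B) : |∑ i, f i| ≤ N * B := by
  refine (Finset.abs_sum_le_sum_abs _ _).trans ?_
  simpa using Finset.sum_le_card_nsmul Finset.univ (fun i => |f i|) B fun i _ => h i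

lemma abs_min_sub_min_le (a b M : ℝ) : |min a M - min b M| ≤ |a - b| := by
  simpa using abs_min_sub_min_le_max a M b M

section Bounds

variable {θ ρ γ K : ℝ} {φ : Finset (Fin N) → ℝ}

/-- Bound on the generator of a `1`-Lipschitz function of a carrier sum. -/
lemma abs_generatorCarrierSum_le (hθ : 0 < θ) (hρ : 0 < ρ) (hγ : 0 ≤ γ) (hK : 0 ≤ K)
    (h0 : ∀ S, 0 ≤ φ S) (hφK : ∀ S, φ S ≤ K) {g : ℝ → ℝ} (hg : ∀ a b, |g a - g b| ≤ |a - b|)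
    (x : Population N) :
    |generatorCarrierSum θ ρ γ g φ x| ≤
      N * (N * (1 / 2 * (K * (pangenome x).card))) + N * (ρ / 2 * K * (pangenome x).card)
        + N * (θ / 2 * K) + N * (N * (γ / (2 * N) * K * (pangenome x).card)) := by
  have hd (S T) : |φ S - φ T| ≤ K := by
    rw [abs_le]; constructor <;> linarith [h0 S, h0 T, hφK S, hφK T]
  unfold generatorCarrierSum
  refine (abs_add_le _ _).trans (add_le_add ((abs_add_le _ _).trans
    (add_le_add ((abs_add_le _ _).trans (add_le_add ?_ ?_)) ?_)) ?_)
  · refine abs_sum_fin_le fun i => abs_sum_fin_le fun j => ?_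
    rw [abs_mul, abs_of_pos (by norm_num : (0 : ℝ) < 1 / 2)]
    gcongr
    refine (hg _ _).trans ?_
    rw [← carrierSum_sub]
    exact abs_carrierSum_le (fun S _ => hd _ _) x
  · refine abs_sum_fin_le fun i => abs_carrierSum_le (fun S _ => ?_) x
    split_ifs
    · rw [abs_mul, abs_of_pos (half_pos hρ)]
      gcongr
      refine (hg _ _).trans ?_
      rw [add_sub_cancel_left]
      exact hd _ _
    · rw [abs_zero]; positivity
  · refine abs_sum_fin_le fun i => ?_
    rw [abs_mul, abs_of_pos (half_pos hθ)]
    gcongr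
    refine (hg _ _).trans ?_
    rw [add_sub_cancel_left, abs_of_nonneg (h0 _)]
    exact hφK _
  · refine abs_sum_fin_le fun i => abs_sum_fin_le fun j => abs_carrierSum_le (fun S _ => ?_) x
    split_ifs
    · rw [abs_mul, abs_of_nonneg (by positivity : 0 ≤ γ / (2 * (N : ℝ)))]
      gcongr
      refine (hg _ _).trans ?_
      rw [add_sub_cancel_left]
      exact hd _ _
    · rw [abs_zero]; positivity

lemma carrierSum_nonneg (h0 : ∀ S, 0 ≤ φ S) (x : Population N) : 0 ≤ carrierSum φ x :=
  Finset.sum_nonneg fun _ _ => h0 _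

lemma mul_card_pangenome_le {a : ℝ} (ha : ∀ S, S.Nonempty → a ≤ φ S) (x : Population N) :
    a * (pangenome x).card ≤ carrierSum φ x := by
  rw [← carrierSum_const]
  exact carrierSum_le ha x

/-- The truncation of a coercive carrier sum has a bounded generator. -/
lemma exists_abs_generatorCarrierSum_min_le (hθ : 0 < θ) (hρ : 0 < ρ) (hγ : 0 ≤ γ) (hK : 0 ≤ K)
    (h0 : ∀ S, 0 ≤ φ S) (hφK : ∀ S, φ S ≤ K) {a : ℝ} (ha : 0 < a)
    (haφ : ∀ S, S.Nonempty → a ≤ φ S) {M : ℝ} (hM : 0 ≤ M) :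
    ∃ C, ∀ x : Population N, |generatorCarrierSum θ ρ γ (fun y => min y M) φ x| ≤ C := by
  refine ⟨max (N * (N * (1 / 2 * (K * ((M + K) / a)))) + N * (ρ / 2 * K * ((M + K) / a))
        + N * (θ / 2 * K) + N * (N * (γ / (2 * N) * K * ((M + K) / a))))
        (N * (N * (1 / 2 * M))), fun x => ?_⟩
  -- Below M + K, coercivity bounds the number of genes. Above it, a change in one gene moves the
  -- sum by at most K and leaves the truncation at M, so only resampling contributes, by at most M
  -- per event.
  by_cases hx : carrierSum φ x < M + K
  · refine le_max_of_le_left ((abs_generatorCarrierSum_le hθ hρ hγ hK h0 hφK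
      (fun b c => abs_min_sub_min_le b c M) x).trans ?_)
    have : ((pangenome x).card : ℝ) ≤ (M + K) / a := by
      rw [le_div_iff₀ ha, mul_comm]
      exact (mul_card_pangenome_le haφ x).trans hx.le
    gcongr
  · push Not at hx
    refine le_max_of_le_right ?_
    have hy : min (carrierSum φ x) M = M := min_eq_right (by linarith)
    have hz (S T) : min (carrierSum φ x + (φ S - φ T)) M = M :=
      min_eq_right (by linarith [h0 S, hφK T])
    have hw (S) : min (carrierSum φ x + φ S) M = M := min_eq_right (by linarith [h0 S])
    have h2 : carrierSum (fun _ => 0) x = 0 := by simp [carrierSum]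
    unfold generatorCarrierSum
    simp only [hy, hz, hw, sub_self, mul_zero, ite_self, h2, Finset.sum_const_zero, add_zero]
    refine abs_sum_fin_le fun i => abs_sum_fin_le fun j => ?_
    rw [abs_mul, abs_of_pos (by norm_num : (0 : ℝ) < 1 / 2)]
    gcongr
    rw [abs_of_nonpos (sub_nonpos.2 (min_le_right _ _))]
    have : 0 ≤ min (carrierSum (fun S => φ (resample i j S)) x) M :=
      le_min (carrierSum_nonneg (fun S => h0 _) x) hM
    linarith

lemma min_sub_min_le_sub {y z M : ℝ} (h : y ≤ M) : min z M - min y M ≤ z - y := by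
  rw [min_eq_left h]; linarith [min_le_left z M]

lemma generatorCarrierSum_min_le (hθ : 0 < θ) (hρ : 0 < ρ) (hγ : 0 ≤ γ) {M : ℝ} {x : Population N}
    (hx : carrierSum φ x ≤ M) :
    generatorCarrierSum θ ρ γ (fun y => min y M) φ x ≤ generatorCarrierSum θ ρ γ id φ x := by
  unfold generatorCarrierSum
  refine add_le_add (add_le_add (add_le_add ?_ ?_) ?_) ?_
  · refine Finset.sum_le_sum fun i _ => Finset.sum_le_sum fun j _ => ?_
    exact mul_le_mul_of_nonneg_left (min_sub_min_le_sub hx) (by norm_num)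
  · refine Finset.sum_le_sum fun i _ => carrierSum_le (fun S _ => ?_) x
    split_ifs
    · exact mul_le_mul_of_nonneg_left (min_sub_min_le_sub hx) (by positivity)
    · exact le_rfl
  · refine Finset.sum_le_sum fun i _ => ?_
    exact mul_le_mul_of_nonneg_left (min_sub_min_le_sub hx) (by positivity)
  · refine Finset.sum_le_sum fun i _ => Finset.sum_le_sum fun j _ =>
      carrierSum_le (fun S _ => ?_) x
    split_ifs
    · exact mul_le_mul_of_nonneg_left (min_sub_min_le_sub hx) (by positivity)
    · exact le_rfl

/-- Here the truncated function is at its maximum, so no jump can increase it. -/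
lemma generatorCarrierSum_min_nonpos (hθ : 0 < θ) (hρ : 0 < ρ) (hγ : 0 ≤ γ) {M : ℝ}
    {x : Population N} (hx : M ≤ carrierSum φ x) :
    generatorCarrierSum θ ρ γ (fun y => min y M) φ x ≤ 0 := by
  have h (z : ℝ) : min z M - min (carrierSum φ x) M ≤ 0 := by
    rw [min_eq_right hx]; linarith [min_le_right z M]
  have hs {ψ : Finset (Fin N) → ℝ} (hψ : ∀ S, ψ S ≤ 0) : carrierSum ψ x ≤ 0 :=
    Finset.sum_nonpos fun _ _ => hψ _
  unfold generatorCarrierSum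
  refine add_nonpos (add_nonpos (add_nonpos ?_ ?_) ?_) ?_
  · exact Finset.sum_nonpos fun i _ => Finset.sum_nonpos fun j _ =>
      mul_nonpos_of_nonneg_of_nonpos (by norm_num) (h _)
  · refine Finset.sum_nonpos fun i _ => hs fun S => ?_
    split_ifs
    · exact mul_nonpos_of_nonneg_of_nonpos (by positivity) (h _)
    · exact le_rfl
  · exact Finset.sum_nonpos fun i _ => mul_nonpos_of_nonneg_of_nonpos (by positivity) (h _)
  · refine Finset.sum_nonpos fun i _ => Finset.sum_nonpos fun j _ => hs fun S => ?_
    split_ifs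
    · exact mul_nonpos_of_nonneg_of_nonpos (by positivity) (h _)
    · exact le_rfl

lemma tendsto_min_natCast (y : ℝ) : Tendsto (fun M : ℕ => min y (M : ℝ)) atTop (𝓝 y) := by
  refine tendsto_const_nhds.congr' ?_
  filter_upwards [tendsto_natCast_atTop_atTop.eventually_ge_atTop y] with M hM
  exact (min_eq_left hM).symm

lemma tendsto_generatorCarrierSum_min (θ ρ γ : ℝ) (φ : Finset (Fin N) → ℝ) (x : Population N) :
    Tendsto (fun M : ℕ => generatorCarrierSum θ ρ γ (fun y => min y (M : ℝ)) φ x) atTop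
      (𝓝 (generatorCarrierSum θ ρ γ id φ x)) := by
  have h (y : ℝ) := tendsto_min_natCast y
  unfold generatorCarrierSum
  refine Tendsto.add (Tendsto.add (Tendsto.add ?_ ?_) ?_) ?_
  · exact tendsto_finsetSum _ fun i _ => tendsto_finsetSum _ fun j _ =>
      ((h _).sub (h _)).const_mul _
  · refine tendsto_finsetSum _ fun i _ => tendsto_finsetSum _ fun u _ => ?_
    beta_reduce
    split_ifs
    · exact ((h _).sub (h _)).const_mul _
    · exact tendsto_const_nhds
  · exact tendsto_finsetSum _ fun i _ => ((h _).sub (h _)).const_mul _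
  · refine tendsto_finsetSum _ fun i _ => tendsto_finsetSum _ fun j _ =>
      tendsto_finsetSum _ fun u _ => ?_
    beta_reduce
    split_ifs
    · exact ((h _).sub (h _)).const_mul _
    · exact tendsto_const_nhds

end Bounds

/-! ### Integrability and the stationary equation -/

section Moments

variable {θ ρ γ : ℝ} {Ω : Type*} [MeasurableSpace Ω] {P : Measure Ω} [IsProbabilityMeasure P]
  {X : ℝ≥0 → Ω → Population N}

lemma integral_generatorCarrierSum_min_eq_zero (hθ : 0 < θ) (hρ : 0 < ρ) (hγ : 0 ≤ γ)
    (hX : IsMoranModel θ ρ γ P X) (hEq : IsInEquilibrium P X) {φ : Finset (Fin N) → ℝ} {K : ℝ}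
    (hφ : φ ∅ = 0) (hK : 0 ≤ K) (h0 : ∀ S, 0 ≤ φ S) (hφK : ∀ S, φ S ≤ K) {a : ℝ} (ha : 0 < a)
    (haφ : ∀ S, S.Nonempty → a ≤ φ S) {M : ℝ} (hM : 0 ≤ M) :
    Integrable (fun ω => generatorCarrierSum θ ρ γ (fun y => min y M) φ (X 0 ω)) P ∧
      ∫ ω, generatorCarrierSum θ ρ γ (fun y => min y M) φ (X 0 ω) ∂P = 0 := by
  have hb := exists_abs_generatorCarrierSum_min_le hθ hρ hγ hK h0 hφK ha haφ hM
  have hg : Measurable fun y : ℝ => min y M := measurable_id.min measurable_const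
  have hgen : generator θ ρ γ (fun x => min (carrierSum φ x) M) =
      generatorCarrierSum θ ρ γ (fun y => min y M) φ :=
    funext fun x => generator_comp_carrierSum θ ρ γ (fun y => min y M) hφ x
  have hmeas := measurable_generatorCarrierSum θ ρ γ hg φ
  constructor
  · obtain ⟨C, hC⟩ := hb
    exact Integrable.of_bound (hmeas.comp (hX.measurable_apply 0)).aestronglyMeasurable C
      (.of_forall fun ω => hC _)
  · have := integral_generator_eq_zero hX hEq (f := fun x => min (carrierSum φ x) M)
      (hg.comp (measurable_carrierSum φ)) ⟨M, fun x => ?_⟩ (by rwa [hgen]) (by rwa [hgen])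
    · rwa [hgen] at this
    · rw [abs_of_nonneg (le_min (carrierSum_nonneg h0 x) hM)]
      exact min_le_right _ _

/-- In equilibrium, the number of genes in the population has finite mean. -/
lemma integrable_card_pangenome (hθ : 0 < θ) (hρ : 0 < ρ) (hγ : 0 ≤ γ)
    (hX : IsMoranModel θ ρ γ P X) (hEq : IsInEquilibrium P X) :
    Integrable (fun ω => ((pangenome (X 0 ω)).card : ℝ)) P := by
  set φ : Finset (Fin N) → ℝ := lyapunov γ
  have hne (S : Finset (Fin N)) (hS : S.Nonempty) := lyapunovRatio_le_lyapunov hγ hS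
  have ha := lyapunovRatio_pos (N := N) hγ
  have h0 (S : Finset (Fin N)) : 0 ≤ φ S := by
    rcases S.eq_empty_or_nonempty with rfl | hS
    · simp [φ]
    · exact (lyapunov_pos hγ hS).le
  set K := ∑ S, φ S
  have hφK (S) : φ S ≤ K := Finset.single_le_sum (fun T _ => h0 T) (Finset.mem_univ S)
  have hK : 0 ≤ K := Finset.sum_nonneg fun S _ => h0 S
  set ε := lyapunovRatio N γ ^ N * (ρ / 2)
  have hε : 0 < ε := mul_pos (pow_pos ha N) (half_pos hρ)
  -- `B` is the input from new genes and `ε` the drift per gene present: the truncated generator is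
  -- at most `B - ε * F M`, and its mean is zero.
  obtain ⟨B, hBdef⟩ : ∃ B, B = θ / 2 * ∑ i, φ {i} := ⟨_, rfl⟩
  have hB : 0 ≤ B := hBdef ▸ mul_nonneg (by positivity) (Finset.sum_nonneg fun i _ => h0 _)
  have hmX := hX.measurable_apply 0
  have hmH : Measurable fun ω => carrierSum φ (X 0 ω) := (measurable_carrierSum φ).comp hmX
  have hmn : Measurable fun ω => ((pangenome (X 0 ω)).card : ℝ) :=
    measurable_card_pangenome.comp hmX
  let F : ℕ → Ω → ℝ := fun M ω =>
    if carrierSum φ (X 0 ω) ≤ M then ((pangenome (X 0 ω)).card : ℝ) else 0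
  have hF0 (M ω) : 0 ≤ F M ω := by simp only [F]; split_ifs <;> positivity
  have hFm (M) : Measurable (F M) :=
    Measurable.ite (measurableSet_le hmH measurable_const) hmn measurable_const
  have hFi (M) : Integrable (F M) P := by
    refine Integrable.of_bound (hFm M).aestronglyMeasurable (M / lyapunovRatio N γ)
      (.of_forall fun ω => ?_)
    rw [Real.norm_of_nonneg (hF0 M ω)]
    simp only [F]
    split_ifs with h
    · rw [le_div_iff₀ ha, mul_comm]
      exact (mul_card_pangenome_le hne _).trans h
    · positivity
  have hFle (M : ℕ) : ∫ ω, F M ω ∂P ≤ B / ε := by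
    obtain ⟨hi, hz⟩ := integral_generatorCarrierSum_min_eq_zero hθ hρ hγ hX hEq (φ := φ)
      (lyapunov_empty γ) hK h0 hφK ha hne (M := M) (Nat.cast_nonneg M)
    have hle : ∫ ω, generatorCarrierSum θ ρ γ (fun y => min y (M : ℝ)) φ (X 0 ω) ∂P ≤
        ∫ ω, (B - ε * F M ω) ∂P := by
      refine integral_mono hi ((integrable_const _).sub ((hFi M).const_mul _)) fun ω => ?_
      simp only [F]
      split_ifs with h
      · refine (generatorCarrierSum_min_le hθ hρ hγ h).trans ?_
        rw [generatorCarrierSum_id, ← hBdef]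
        have : carrierSum (carrierGenerator ρ γ φ) (X 0 ω) ≤ carrierSum (fun _ => -ε) (X 0 ω) :=
          carrierSum_le (fun S hS => carrierGenerator_lyapunov_le hρ hγ hS) _
        rw [carrierSum_const] at this
        linarith
      · push Not at h
        refine (generatorCarrierSum_min_nonpos hθ hρ hγ h.le).trans ?_
        simpa using hB
    rw [hz, integral_sub (integrable_const _) ((hFi M).const_mul _), integral_const_mul] at hle
    simp only [integral_const, probReal_univ, one_smul] at hle
    rw [le_div_iff₀ hε]
    linarith
  refine ⟨hmn.aestronglyMeasurable, ?_⟩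
  rw [hasFiniteIntegral_iff_ofReal (.of_forall fun ω => Nat.cast_nonneg _)]
  have hlim (ω) : liminf (fun M => ENNReal.ofReal (F M ω)) atTop =
      ENNReal.ofReal ((pangenome (X 0 ω)).card : ℝ) := by
    refine Tendsto.liminf_eq (tendsto_const_nhds.congr' ?_)
    filter_upwards [tendsto_natCast_atTop_atTop.eventually_ge_atTop
      (carrierSum φ (X 0 ω))] with M hM
    simp [F, hM]
  -- Fatou's lemma carries the uniform bound B / ε over to the untruncated count.
  calc ∫⁻ ω, ENNReal.ofReal ((pangenome (X 0 ω)).card : ℝ) ∂P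
      = ∫⁻ ω, liminf (fun M => ENNReal.ofReal (F M ω)) atTop ∂P := by simp_rw [hlim]
    _ ≤ liminf (fun M => ∫⁻ ω, ENNReal.ofReal (F M ω) ∂P) atTop :=
        lintegral_liminf_le fun M => (hFm M).ennreal_ofReal
    _ ≤ liminf (fun _ : ℕ => ENNReal.ofReal (B / ε)) atTop := by
        refine liminf_le_liminf (.of_forall fun M => ?_)
        rw [← ofReal_integral_eq_lintegral_ofReal (hFi M) (.of_forall (hF0 M))]
        exact ENNReal.ofReal_le_ofReal (hFle M)
    _ < ⊤ := by simp

lemma integrable_carrierSum (hθ : 0 < θ) (hρ : 0 < ρ) (hγ : 0 ≤ γ)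
    (hX : IsMoranModel θ ρ γ P X) (hEq : IsInEquilibrium P X) (φ : Finset (Fin N) → ℝ) :
    Integrable (fun ω => carrierSum φ (X 0 ω)) P := by
  refine ((integrable_card_pangenome hθ hρ hγ hX hEq).const_mul (∑ S, |φ S|)).mono'
    ((measurable_carrierSum φ).comp (hX.measurable_apply 0)).aestronglyMeasurable
    (.of_forall fun ω => ?_)
  exact abs_carrierSum_le (fun S _ => Finset.single_le_sum (f := fun S => |φ S|)
    (fun T _ => abs_nonneg _) (Finset.mem_univ S)) _

/-- The truncation level tends to infinity; the Lipschitz bound on the generator is affine in the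
number of genes, which is integrable, so dominated convergence applies. -/
lemma integral_carrierSum_carrierGenerator_of_pos (hθ : 0 < θ) (hρ : 0 < ρ) (hγ : 0 ≤ γ)
    (hX : IsMoranModel θ ρ γ P X) (hEq : IsInEquilibrium P X) {φ : Finset (Fin N) → ℝ}
    (hφ : φ ∅ = 0) {a : ℝ} (ha : 0 < a) (haφ : ∀ S, S.Nonempty → a ≤ φ S) :
    ∫ ω, carrierSum (carrierGenerator ρ γ φ) (X 0 ω) ∂P = -(θ / 2 * ∑ i, φ {i}) := by
  have h0 (S : Finset (Fin N)) : 0 ≤ φ S := by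
    rcases S.eq_empty_or_nonempty with rfl | hS
    · exact hφ.ge
    · exact ha.le.trans (haφ S hS)
  set K := ∑ S, φ S
  have hφK (S) : φ S ≤ K := Finset.single_le_sum (fun T _ => h0 T) (Finset.mem_univ S)
  have hK : 0 ≤ K := Finset.sum_nonneg fun S _ => h0 S
  have hn := integrable_card_pangenome hθ hρ hγ hX hEq
  have hlim := tendsto_integral_of_dominated_convergence (μ := P)
    (F := fun (M : ℕ) ω => generatorCarrierSum θ ρ γ (fun y => min y (M : ℝ)) φ (X 0 ω))
    (f := fun ω => generatorCarrierSum θ ρ γ id φ (X 0 ω)) _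
    (fun M => (integral_generatorCarrierSum_min_eq_zero hθ hρ hγ hX hEq hφ hK h0 hφK ha haφ
      (Nat.cast_nonneg M)).1.aestronglyMeasurable)
    ?_ (fun M => .of_forall fun ω => abs_generatorCarrierSum_le hθ hρ hγ hK h0 hφK
      (fun b c => abs_min_sub_min_le b c M) _)
    (.of_forall fun ω => tendsto_generatorCarrierSum_min θ ρ γ φ _)
  · simp_rw [fun M : ℕ => (integral_generatorCarrierSum_min_eq_zero hθ hρ hγ hX hEq hφ hK h0 hφK ha
      haφ (Nat.cast_nonneg M)).2, generatorCarrierSum_id] at hlim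
    have h1 := tendsto_nhds_unique hlim tendsto_const_nhds
    rw [integral_add (integrable_carrierSum hθ hρ hγ hX hEq _) (integrable_const _)] at h1
    simp only [integral_const, probReal_univ, one_smul] at h1
    linarith
  · exact (((((hn.const_mul _).const_mul _).const_mul _).const_mul _).add
      ((hn.const_mul _).const_mul _)).add (integrable_const _) |>.add
      (((hn.const_mul _).const_mul _).const_mul _)

/-- The stationary equation for the mean carrier sums. -/
lemma integral_carrierSum_carrierGenerator (hθ : 0 < θ) (hρ : 0 < ρ) (hγ : 0 ≤ γ)
    (hX : IsMoranModel θ ρ γ P X) (hEq : IsInEquilibrium P X) {φ : Finset (Fin N) → ℝ}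
    (hφ : φ ∅ = 0) :
    ∫ ω, carrierSum (carrierGenerator ρ γ φ) (X 0 ω) ∂P = -(θ / 2 * ∑ i, φ {i}) := by
  set K := 1 + ∑ S, |φ S|
  have hKφ (S) : |φ S| ≤ ∑ S, |φ S| :=
    Finset.single_le_sum (f := fun S => |φ S|) (fun T _ => abs_nonneg _) (Finset.mem_univ S)
  have hK : 0 < K := by
    have := Finset.sum_nonneg fun (S : Finset (Fin N)) (_ : S ∈ Finset.univ) => abs_nonneg (φ S)
    simp only [K]; linarith
  -- Both `χ` and `φ + χ` are bounded below by a positive constant on nonempty sets; the equation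
  -- for `φ` is the difference of theirs.
  let χ : Finset (Fin N) → ℝ := fun S => if S = ∅ then 0 else K
  have h1 := integral_carrierSum_carrierGenerator_of_pos hθ hρ hγ hX hEq (φ := χ) (by simp [χ]) hK
    fun S hS => by simp [χ, hS.ne_empty]
  have h2 := integral_carrierSum_carrierGenerator_of_pos hθ hρ hγ hX hEq
    (φ := fun S => φ S + χ S) (by simp [χ, hφ]) one_pos fun S hS => by
      simp only [χ, hS.ne_empty, if_false, K]; linarith [neg_abs_le (φ S), hKφ S]
  have h3 : carrierGenerator ρ γ (fun S => φ S + χ S) =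
      fun S => carrierGenerator ρ γ φ S + carrierGenerator ρ γ χ S :=
    funext (carrierGenerator_add ρ γ φ χ)
  simp_rw [h3, carrierSum_add] at h2
  rw [integral_add (integrable_carrierSum hθ hρ hγ hX hEq _)
    (integrable_carrierSum hθ hρ hγ hX hEq _), h1, Finset.sum_add_distrib] at h2
  linarith

end Moments

/-! ### The mean number of genes with given carriers -/

/-- The mean number in equilibrium of genes with a given set of `k ≥ 1` carriers. -/
def carrierWeight (θ ρ γ : ℝ) (N k : ℕ) : ℝ :=
  θ * (k - 1).factorial * (1 + γ / N) ^ (k - 1) / ∏ l ∈ Finset.range k, ((N : ℝ) - 1 - l + ρ)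

lemma carrierWeight_succ (θ ρ γ : ℝ) (N k : ℕ) :
    carrierWeight θ ρ γ N (k + 1) = θ * k.factorial * (1 + γ / N) ^ k /
      ∏ l ∈ Finset.range (k + 1), ((N : ℝ) - 1 - l + ρ) := rfl

/-- Boundary case of detailed balance: extinction of genes with one carrier offsets the gain of new
genes. -/
lemma carrierWeight_one_mul_lossRate (θ : ℝ) {ρ : ℝ} (hρ : 0 < ρ) (γ : ℝ) (hN : 1 ≤ N) :
    carrierWeight θ ρ γ N 1 * lossRate N ρ 1 = θ / 2 := by
  have hN' : (1 : ℝ) ≤ N := by exact_mod_cast hN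
  have h : (N : ℝ) - 1 + ρ ≠ 0 := by linarith
  rw [carrierWeight_succ, lossRate]
  simp only [zero_add, Finset.prod_range_one, Nat.cast_zero, sub_zero, Nat.cast_one,
    Nat.factorial_zero, pow_zero, mul_one]
  field_simp

/-- Detailed balance between the sets of carriers of size `k` and `k + 1`. -/
lemma carrierWeight_succ_mul_lossRate (θ : ℝ) {ρ : ℝ} (hρ : 0 < ρ) (γ : ℝ) {k : ℕ} (hk : 1 ≤ k)
    (hkN : k + 1 ≤ N) :
    carrierWeight θ ρ γ N (k + 1) * lossRate N ρ (k + 1) =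
      carrierWeight θ ρ γ N k * gainRate N γ k := by
  obtain ⟨k, rfl⟩ := Nat.exists_eq_succ_of_ne_zero (Nat.one_le_iff_ne_zero.1 hk)
  have hN' : (k : ℝ) + 1 + 1 ≤ N := by exact_mod_cast hkN
  rw [Nat.succ_eq_add_one, carrierWeight_succ, carrierWeight_succ, Finset.prod_range_succ,
    lossRate, gainRate, pow_succ, Nat.factorial_succ]
  have h : (N : ℝ) - 1 - (k + 1) + ρ ≠ 0 := by linarith
  have h2 : γ / (2 * (N : ℝ)) = γ / N / 2 := by rw [mul_comm, div_div]
  rw [h2]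
  push_cast
  set p := ∏ l ∈ Finset.range (k + 1), ((N : ℝ) - 1 - l + ρ)
  rw [show (N : ℝ) - (k + 1 + 1) + ρ = N - 1 - (k + 1) + ρ by ring]
  set q := (N : ℝ) - 1 - (k + 1) + ρ
  rw [div_mul_eq_mul_div, div_mul_eq_mul_div, mul_div_mul_comm]
  rw [← mul_div_mul_comm, mul_comm p q, ← div_div]
  congr 1
  rw [div_eq_iff h]
  ring

lemma sum_sum_mem_eq_sum_sum_compl (F : Finset (Fin N) → Fin N → ℝ) :
    ∑ S, ∑ j ∈ S, F S j = ∑ T : Finset (Fin N), ∑ j ∈ Tᶜ, F (insert j T) j := by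
  rw [Finset.sum_sigma', Finset.sum_sigma']
  refine Finset.sum_nbij' (fun p => ⟨p.1.erase p.2, p.2⟩) (fun p => ⟨insert p.2 p.1, p.2⟩)
    ?_ ?_ ?_ ?_ ?_
  · rintro ⟨S, j⟩ h; simp
  · rintro ⟨S, j⟩ h; simp
  · rintro ⟨S, j⟩ h
    simp only [Finset.mem_sigma, Finset.mem_univ, true_and] at h
    simp [Finset.insert_erase h]
  · rintro ⟨S, j⟩ h
    simp only [Finset.mem_sigma, Finset.mem_univ, true_and, Finset.mem_compl] at h
    simp [Finset.erase_insert h]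
  · rintro ⟨S, j⟩ h
    simp only [Finset.mem_sigma, Finset.mem_univ, true_and] at h
    simp [Finset.insert_erase h]

/-- Summation by parts over the pairs T, T ∪ {j}: detailed balance kills every pair except those
with T = ∅, which yield the gain term. -/
lemma sum_carrierWeight_mul_carrierGenerator (θ : ℝ) {ρ : ℝ} (hρ : 0 < ρ) (γ : ℝ)
    {φ : Finset (Fin N) → ℝ} (hφ : φ ∅ = 0) :
    ∑ S, carrierWeight θ ρ γ N S.card * carrierGenerator ρ γ φ S = -(θ / 2 * ∑ i, φ {i}) := by
  have h1 : ∑ S : Finset (Fin N), carrierWeight θ ρ γ N S.card * carrierGenerator ρ γ φ S =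
      ∑ T : Finset (Fin N), ∑ j ∈ Tᶜ,
        (carrierWeight θ ρ γ N T.card * gainRate N γ T.card -
          carrierWeight θ ρ γ N (T.card + 1) * lossRate N ρ (T.card + 1)) *
            (φ (insert j T) - φ T) := by
    unfold carrierGenerator
    simp_rw [mul_add, Finset.sum_add_distrib, Finset.mul_sum]
    rw [sum_sum_mem_eq_sum_sum_compl fun S j =>
      carrierWeight θ ρ γ N S.card * (lossRate N ρ S.card * (φ (S.erase j) - φ S)),
      ← Finset.sum_add_distrib]
    refine Finset.sum_congr rfl fun T _ => ?_
    rw [← Finset.sum_add_distrib]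
    refine Finset.sum_congr rfl fun j hj => ?_
    rw [Finset.card_insert_of_notMem (Finset.mem_compl.1 hj),
      Finset.erase_insert (Finset.mem_compl.1 hj)]
    ring
  -- The value of `carrierWeight` at 0 carriers is arbitrary: it is multiplied by the gain rate 0.
  rw [h1, Finset.sum_eq_single ∅]
  · rw [Finset.mul_sum, ← Finset.sum_neg_distrib, Finset.compl_empty]
    refine Finset.sum_congr rfl fun j _ => ?_
    have hN : 1 ≤ N := (Nat.zero_le _).trans_lt j.2
    rw [Finset.card_empty, zero_add, carrierWeight_one_mul_lossRate θ hρ γ hN, hφ]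
    simp [gainRate]
  · intro T _ hT
    refine Finset.sum_eq_zero fun j hj => ?_
    have hc : T.card + 1 ≤ N := by
      rw [← Finset.card_insert_of_notMem (Finset.mem_compl.1 hj)]
      exact card_finset_fin_le _
    rw [carrierWeight_succ_mul_lossRate θ hρ γ
      (Finset.card_pos.2 (Finset.nonempty_iff_ne_empty.2 hT)) hc, sub_self, zero_mul]
  · simp

/-- The mean in equilibrium of any carrier sum. -/
lemma integral_carrierSum {θ ρ γ : ℝ} {Ω : Type*} [MeasurableSpace Ω] {P : Measure Ω}
    [IsProbabilityMeasure P] {X : ℝ≥0 → Ω → Population N} (hθ : 0 < θ) (hρ : 0 < ρ) (hγ : 0 ≤ γ)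
    (hX : IsMoranModel θ ρ γ P X) (hEq : IsInEquilibrium P X) {ψ : Finset (Fin N) → ℝ}
    (hψ : ψ ∅ = 0) :
    ∫ ω, carrierSum ψ (X 0 ω) ∂P = ∑ S, carrierWeight θ ρ γ N S.card * ψ S := by
  obtain ⟨φ, hφ, rfl⟩ := exists_carrierGenerator_eq hρ hγ hψ
  rw [integral_carrierSum_carrierGenerator hθ hρ hγ hX hEq hφ,
    sum_carrierWeight_mul_carrierGenerator θ hρ γ hφ]

/-! ### Genes of one individual that are absent from others -/

lemma card_sdiff_biUnion_eq_carrierSum (x : Population N) (i : Fin N) (R : Finset (Fin N)) :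
    (((x i).genes \ R.biUnion fun r => (x r).genes).card : ℝ) =
      carrierSum (fun S => if i ∈ S ∧ Disjoint S R then 1 else 0) x := by
  unfold carrierSum
  rw [← Finset.sum_filter, Finset.sum_const, nsmul_eq_mul, mul_one]
  congr 2
  ext u
  simp only [Finset.mem_sdiff, Finset.mem_biUnion, Finset.mem_filter, mem_carriers,
    Finset.disjoint_left, mem_pangenome]
  constructor
  · rintro ⟨h1, h2⟩
    exact ⟨⟨i, h1⟩, h1, fun r hr hR => h2 ⟨r, hR, hr⟩⟩
  · rintro ⟨-, h1, h2⟩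
    exact ⟨h1, fun ⟨r, hR, hr⟩ => h2 hr hR⟩

/-- Removing `i` matches these sets with the subsets of the `M` individuals outside {i} ∪ R. -/
lemma sum_ite_mem_disjoint (w : ℕ → ℝ) {i : Fin N} {R : Finset (Fin N)} (hi : i ∉ R) {M : ℕ}
    (hM : M + 1 + R.card = N) :
    (∑ S : Finset (Fin N), w S.card * if i ∈ S ∧ Disjoint S R then 1 else 0) =
      ∑ k ∈ Finset.range (M + 1), (M.choose k : ℝ) * w (k + 1) := by
  have hcard : (insert i R)ᶜ.card = M := by
    rw [Finset.card_compl, Fintype.card_fin, Finset.card_insert_of_notMem hi]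
    omega
  have h := Finset.sum_powerset_apply_card (fun k => w (k + 1)) (x := (insert i R)ᶜ)
  simp only [hcard, nsmul_eq_mul] at h
  rw [← h]
  simp_rw [mul_ite, mul_one, mul_zero]
  rw [← Finset.sum_filter]
  have hmem (T : Finset (Fin N)) (hT : T ∈ (insert i R)ᶜ.powerset) : i ∉ T ∧ Disjoint T R := by
    rw [Finset.mem_powerset, Finset.subset_compl_iff_disjoint_right, Finset.disjoint_insert_right]
      at hT
    exact hT
  refine Finset.sum_nbij' (fun S => S.erase i) (fun T => insert i T) ?_ ?_ ?_ ?_ ?_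
  · intro S hS
    simp only [Finset.mem_filter, Finset.mem_univ, true_and] at hS
    rw [Finset.mem_powerset, Finset.subset_compl_iff_disjoint_right, Finset.disjoint_insert_right]
    exact ⟨Finset.notMem_erase i S, hS.2.mono_left (Finset.erase_subset i S)⟩
  · intro T hT
    simp only [Finset.mem_filter, Finset.mem_univ, true_and]
    exact ⟨Finset.mem_insert_self i T, Finset.disjoint_insert_left.2 ⟨hi, (hmem T hT).2⟩⟩
  · intro S hS
    simp only [Finset.mem_filter, Finset.mem_univ, true_and] at hS
    exact Finset.insert_erase hS.1
  · intro T hT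
    exact Finset.erase_insert (hmem T hT).1
  · intro S hS
    simp only [Finset.mem_filter, Finset.mem_univ, true_and] at hS
    rw [Finset.card_erase_add_one hS.1]

end Carriers

section Limit


/-! ### Rising factorials and the limit of the means -/

@[simp] lemma rising_zero (a : ℝ) : rising a 0 = 1 := by simp [rising]

lemma rising_succ (a : ℝ) (m : ℕ) : rising a (m + 1) = rising a m * (a + m) := by
  simp [rising, ascPochhammer_succ_eval]

lemma rising_succ_left (a : ℝ) (m : ℕ) : rising a (m + 1) = a * rising (a + 1) m := by
  simp [rising, ascPochhammer_succ_left]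

lemma rising_pos {a : ℝ} (ha : 0 < a) (m : ℕ) : 0 < rising a m := ascPochhammer_pos m a ha

lemma mul_factorial_le_rising {a : ℝ} (ha : 0 < a) (m : ℕ) :
    a * m.factorial ≤ rising a (m + 1) := by
  induction m with
  | zero => simp [rising_succ]
  | succ m ih =>
    rw [rising_succ, Nat.factorial_succ]
    push_cast
    calc a * (((m : ℝ) + 1) * m.factorial) = a * m.factorial * (m + 1) := by ring
      _ ≤ rising a (m + 1) * (a + (m + 1)) :=
        mul_le_mul ih (by linarith) (by positivity) (rising_pos ha _).le

lemma summable_pow_div_rising {a : ℝ} (ha : 0 < a) {γ : ℝ} (hγ : 0 ≤ γ) :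
    Summable fun m : ℕ => γ ^ m / rising a (m + 1) := by
  refine Summable.of_nonneg_of_le (fun m => by have := rising_pos ha (m + 1); positivity)
    (fun m => ?_) ((Real.summable_pow_div_factorial γ).mul_left a⁻¹)
  have := mul_factorial_le_rising ha m
  calc γ ^ m / rising a (m + 1) ≤ γ ^ m / (a * m.factorial) := by gcongr
    _ = a⁻¹ * (γ ^ m / m.factorial) := by field_simp

/-- The telescoping identity for reciprocals of rising factorials. -/
lemma sum_inv_rising {a : ℝ} (ha : 0 < a) (m n : ℕ) :
    ∑ l ∈ Finset.range n, 1 / rising (a + l) (m + 2) =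
      1 / ((m + 1 : ℕ) : ℝ) * (1 / rising a (m + 1) - 1 / rising (n + a) (m + 1)) := by
  have h (l : ℕ) : 1 / rising (a + l) (m + 2) = 1 / ((m + 1 : ℕ) : ℝ) *
      (1 / rising (a + l) (m + 1) - 1 / rising (a + (l + 1 : ℕ)) (m + 1)) := by
    have hb : 0 < a + l := by positivity
    have hr := rising_pos hb (m + 1)
    have hr' := rising_pos (by positivity : 0 < a + l + 1) (m + 1)
    have e1 := rising_succ (a + l) (m + 1)
    have e2 := rising_succ_left (a + l) (m + 1)
    have h1 : 1 / rising (a + l) (m + 1) = (a + l + (m + 1 : ℕ)) / rising (a + l) (m + 2) := by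
      rw [e1]; field_simp
    have h2 : 1 / rising (a + l + 1) (m + 1) = (a + l) / rising (a + l) (m + 2) := by
      rw [e2]; field_simp
    rw [show a + ((l + 1 : ℕ) : ℝ) = a + l + 1 by push_cast; ring, h1, h2]
    have := rising_pos hb (m + 2)
    field_simp
    ring
  simp_rw [h]
  rw [← Finset.mul_sum, Finset.sum_range_sub' fun l : ℕ => 1 / rising (a + l) (m + 1)]
  simp [add_comm]

/-- A finite sum identity, proved by comparing first-order recurrences in `M`. -/
lemma sum_descFactorial_div_prod {a : ℝ} (ha : 0 < a) (y : ℝ) (M : ℕ) :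
    ∑ k ∈ Finset.range (M + 1), (M.descFactorial k : ℝ) * (1 + y) ^ k /
        ∏ l ∈ Finset.range (k + 1), (a + M - l) =
      ∑ m ∈ Finset.range (M + 1), y ^ m * M.descFactorial m / rising a (m + 1) := by
  induction M with
  | zero => simp [rising_succ]
  | succ M ih =>
    have hM : a + ((M + 1 : ℕ) : ℝ) ≠ 0 := by positivity
    -- Splitting off k = 0 leaves (M+1)(1+y)/(a+M+1) times the sum for M.
    have hL : ∑ k ∈ Finset.range (M + 1 + 1), ((M + 1).descFactorial k : ℝ) * (1 + y) ^ k /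
        ∏ l ∈ Finset.range (k + 1), (a + ((M + 1 : ℕ) : ℝ) - l) =
        (1 + (M + 1) * (1 + y) * ∑ k ∈ Finset.range (M + 1), (M.descFactorial k : ℝ) *
          (1 + y) ^ k / ∏ l ∈ Finset.range (k + 1), (a + M - l)) / (a + ((M + 1 : ℕ) : ℝ)) := by
      rw [Finset.sum_range_succ', add_div, Finset.mul_sum, Finset.sum_div, add_comm]
      congr 1
      · simp
      · refine Finset.sum_congr rfl fun k _ => ?_
        rw [Finset.prod_range_succ', Nat.succ_descFactorial_succ, pow_succ]
        have : ∏ l ∈ Finset.range (k + 1), (a + ((M + 1 : ℕ) : ℝ) - ((l + 1 : ℕ) : ℝ)) =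
            ∏ l ∈ Finset.range (k + 1), (a + M - l) :=
          Finset.prod_congr rfl fun l _ => by push_cast; ring
        rw [this, Nat.cast_zero, sub_zero, ← div_div, Nat.cast_mul, ← mul_div_assoc]
        push_cast
        ring
    rw [hL, ih, div_eq_iff hM, Finset.sum_range_succ' _ (M + 1)]
    -- The index can be shifted because the falling factorial vanishes at m = M + 1.
    have hR : ∑ m ∈ Finset.range (M + 1), y ^ m * (M.descFactorial m : ℝ) / rising a (m + 1) =
        ∑ m ∈ Finset.range (M + 1),
          y ^ (m + 1) * (M.descFactorial (m + 1) : ℝ) / rising a (m + 1 + 1) + 1 / a := by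
      have := Finset.sum_range_succ' (fun m => y ^ m * (M.descFactorial m : ℝ) / rising a (m + 1))
        (M + 1)
      rw [Finset.sum_range_succ, Nat.descFactorial_of_lt (Nat.lt_succ_self M)] at this
      simpa [rising_succ] using this
    -- This is the splitting a + M + 1 = (M - m) + (a + m + 1).
    have hterm (m : ℕ) (hm : m ∈ Finset.range (M + 1)) :
        (a + ((M + 1 : ℕ) : ℝ)) *
          (y ^ (m + 1) * ((M + 1).descFactorial (m + 1) : ℝ) / rising a (m + 1 + 1)) =
        (M + 1) * (y ^ (m + 1) * (M.descFactorial (m + 1) : ℝ) / rising a (m + 1 + 1)) +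
        (M + 1) * y * (y ^ m * (M.descFactorial m : ℝ) / rising a (m + 1)) := by
      have hm' : m ≤ M := Nat.lt_succ_iff.1 (Finset.mem_range.1 hm)
      have hr := rising_pos ha (m + 1)
      have hr2 : a + ((m + 1 : ℕ) : ℝ) ≠ 0 := by positivity
      have h1 : y ^ m * (M.descFactorial m : ℝ) / rising a (m + 1) =
          y ^ m * (M.descFactorial m : ℝ) * (a + ((m + 1 : ℕ) : ℝ)) / rising a (m + 1 + 1) := by
        rw [rising_succ a (m + 1)]; field_simp
      rw [h1, Nat.succ_descFactorial_succ, Nat.descFactorial_succ, Nat.cast_mul, Nat.cast_mul,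
        Nat.cast_sub hm']
      push_cast
      ring
    have hsum := Finset.sum_congr rfl hterm
    rw [Finset.sum_add_distrib, ← Finset.mul_sum, ← Finset.mul_sum, ← Finset.mul_sum] at hsum
    have h0 : y ^ 0 * ((M + 1).descFactorial 0 : ℝ) / rising a (0 + 1) = 1 / a := by
      simp [rising_succ]
    have h2 : (a + ((M + 1 : ℕ) : ℝ)) * (1 / a) = 1 + (M + 1) * (1 / a) := by
      push_cast; field_simp
    rw [h0]
    linear_combination (M + 1 : ℝ) * hR - hsum - h2

/-- Powers of 1 + γ/N become powers of γ/N, whose coefficients converge termwise as N grows. -/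
lemma sum_choose_mul_carrierWeight (θ : ℝ) {ρ : ℝ} (hρ : 0 < ρ) (γ : ℝ) {N M l : ℕ}
    (h : M + 1 + l = N) :
    ∑ k ∈ Finset.range (M + 1), (M.choose k : ℝ) * carrierWeight θ ρ γ N (k + 1) =
      θ * ∑ m ∈ Finset.range (M + 1),
        (γ / N) ^ m * M.descFactorial m / rising (ρ + l) (m + 1) := by
  rw [← sum_descFactorial_div_prod (by positivity), Finset.mul_sum]
  refine Finset.sum_congr rfl fun k _ => ?_
  have hp : ∏ j ∈ Finset.range (k + 1), ((N : ℝ) - 1 - j + ρ) =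
      ∏ j ∈ Finset.range (k + 1), (ρ + l + M - j) :=
    Finset.prod_congr rfl fun j _ => by rw [← h]; push_cast; ring
  rw [carrierWeight_succ, hp, Nat.descFactorial_eq_factorial_mul_choose]
  push_cast
  ring

lemma tendsto_descFactorial_div_pow (l m : ℕ) :
    Tendsto (fun N : ℕ => ((N - 1 - l).descFactorial m : ℝ) / (N : ℝ) ^ m) atTop (𝓝 1) := by
  induction m with
  | zero => simp
  | succ m ih =>
    have h1 : Tendsto (fun N : ℕ => ((N - 1 - l - m : ℕ) : ℝ) / N) atTop (𝓝 1) := by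
      have h2 : Tendsto (fun N : ℕ => 1 - ((1 + l + m : ℕ) : ℝ) / N) atTop (𝓝 (1 - 0)) :=
        tendsto_const_nhds.sub (tendsto_const_div_atTop_nhds_zero_nat _)
      rw [sub_zero] at h2
      refine h2.congr' ?_
      filter_upwards [eventually_ge_atTop (1 + l + m), eventually_gt_atTop 0] with N hN hN0
      rw [Nat.sub_sub, Nat.sub_sub, ← add_assoc, Nat.cast_sub hN, sub_div, div_self (by positivity)]
    have := h1.mul ih
    rw [one_mul] at this
    refine this.congr fun N => ?_
    rw [Nat.descFactorial_succ, pow_succ, Nat.cast_mul]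
    ring

/-- Convergence of the mean number of genes of one individual that are absent from `l` others. -/
lemma tendsto_sum_choose_mul_carrierWeight (θ : ℝ) {ρ γ : ℝ} (hρ : 0 < ρ) (hγ : 0 ≤ γ) (l : ℕ) :
    Tendsto (fun N : ℕ => ∑ k ∈ Finset.range (N - 1 - l + 1),
        ((N - 1 - l).choose k : ℝ) * carrierWeight θ ρ γ N (k + 1)) atTop
      (𝓝 (θ * ∑' m : ℕ, γ ^ m / rising (ρ + l) (m + 1))) := by
  have ha : 0 < ρ + l := by positivity
  -- The finite sum extends to a series since falling factorials vanish beyond their argument; they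
  -- are at most N^m, which gives the summable majorant.
  have hlim : Tendsto (fun N : ℕ => ∑' m : ℕ,
      (γ / N) ^ m * ((N - 1 - l).descFactorial m : ℝ) / rising (ρ + l) (m + 1)) atTop
      (𝓝 (∑' m : ℕ, γ ^ m / rising (ρ + l) (m + 1))) := by
    refine tendsto_tsum_of_dominated_convergence (summable_pow_div_rising ha hγ) (fun m => ?_)
      (.of_forall fun N m => ?_)
    · have := (tendsto_descFactorial_div_pow l m).mul_const (γ ^ m / rising (ρ + l) (m + 1))
      rw [one_mul] at this
      refine this.congr fun N => ?_
      rw [div_pow]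
      ring
    · have hr := rising_pos ha (m + 1)
      rw [Real.norm_of_nonneg (by positivity)]
      gcongr
      rw [div_pow, div_mul_eq_mul_div, mul_div_assoc]
      refine mul_le_of_le_one_right (by positivity) (div_le_one_of_le₀ ?_ (by positivity))
      have h1 : (N - 1 - l).descFactorial m ≤ N ^ m :=
        (Nat.descFactorial_le_pow _ _).trans (Nat.pow_le_pow_left (by omega) _)
      exact_mod_cast h1
  refine (hlim.const_mul θ).congr' ?_
  filter_upwards [eventually_ge_atTop (1 + l)] with N hN
  rw [sum_choose_mul_carrierWeight θ hρ γ (by omega : N - 1 - l + 1 + l = N)]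
  congr 1
  refine tsum_eq_sum fun m hm => ?_
  rw [Finset.mem_range, not_lt] at hm
  rw [Nat.descFactorial_of_lt hm]
  simp

lemma tsum_pow_div_rising {a γ : ℝ} (ha : 0 < a) (hγ : 0 ≤ γ) :
    ∑' m : ℕ, γ ^ m / rising a (m + 1) =
      1 / a * (1 + ∑' m : ℕ, γ ^ (m + 1) / rising (1 + a) (m + 1)) := by
  rw [(summable_pow_div_rising ha hγ).tsum_eq_zero_add, mul_add, ← tsum_mul_left]
  congr 1
  · simp [rising_succ]
  · refine tsum_congr fun m => ?_
    rw [rising_succ_left a (m + 1), add_comm 1 a]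
    have := rising_pos (by positivity : 0 < a + 1) (m + 1)
    field_simp

lemma summable_pow_succ_div_rising {a γ : ℝ} (ha : 0 < a) (hγ : 0 ≤ γ) :
    Summable fun m : ℕ => γ ^ (m + 1) / rising a (m + 1) := by
  refine ((summable_pow_div_rising ha hγ).mul_left γ).congr fun m => ?_
  rw [pow_succ]
  ring

/-- Undoing the telescoping gives both convergence and the value of the series in the third limit.
-/
lemma pow_div_mul_sub_inv_rising {a : ℝ} (ha : 0 < a) (γ : ℝ) (n m : ℕ) :
    γ ^ (m + 1) / ((m + 1 : ℕ) : ℝ) * (1 / rising a (m + 1) - 1 / rising (n + a) (m + 1)) =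
      ∑ l ∈ Finset.range n, γ ^ (m + 1) / rising (a + l) (m + 1 + 1) := by
  rw [div_eq_mul_one_div, mul_assoc, ← sum_inv_rising ha, Finset.mul_sum]
  exact Finset.sum_congr rfl fun l _ => by ring

lemma summable_pow_div_mul_sub_inv_rising {a γ : ℝ} (ha : 0 < a) (hγ : 0 ≤ γ) (n : ℕ) :
    Summable fun m : ℕ => γ ^ (m + 1) / ((m + 1 : ℕ) : ℝ) *
      (1 / rising a (m + 1) - 1 / rising (n + a) (m + 1)) := by
  simp_rw [pow_div_mul_sub_inv_rising ha]
  refine summable_sum fun l _ => ?_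
  exact (summable_nat_add_iff 1).2 (summable_pow_div_rising (by positivity : 0 < a + l) hγ)

lemma sum_tsum_pow_div_rising {a γ : ℝ} (ha : 0 < a) (hγ : 0 ≤ γ) (n : ℕ) :
    ∑ l ∈ Finset.range n, ∑' m : ℕ, γ ^ m / rising (a + l) (m + 1) =
      ∑ k ∈ Finset.range n, 1 / ((k : ℝ) + a) +
        ∑' m : ℕ, γ ^ (m + 1) / ((m + 1 : ℕ) : ℝ) *
          (1 / rising a (m + 1) - 1 / rising (n + a) (m + 1)) := by
  have hs (l : ℕ) := summable_pow_div_rising (by positivity : 0 < a + l) hγ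
  simp_rw [pow_div_mul_sub_inv_rising ha]
  rw [Summable.tsum_finsetSum fun l _ => (summable_nat_add_iff 1).2 (hs l),
    ← Finset.sum_add_distrib]
  refine Finset.sum_congr rfl fun l _ => ?_
  rw [(hs l).tsum_eq_zero_add]
  congr 1
  simp [rising_succ, add_comm]

end Limit


/-! ### Statistics of the sample -/

section Sample

variable {N n : ℕ}

/-- The number of genes of `i` in the sample that no individual in `R` carries. -/
def privateGenes (x : Population N) (i : Fin n) (R : Finset (Fin n)) : ℝ :=
  ((sample n x i \ R.biUnion (sample n x)).card : ℝ)

/-- The individuals in the population that correspond to a subset of the sample. -/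
def sampledIn (N : ℕ) (R : Finset (Fin n)) : Finset (Fin N) :=
  Finset.univ.filter fun r => ∃ s ∈ R, (s : ℕ) = r

lemma biUnion_sample (x : Population N) (R : Finset (Fin n)) :
    R.biUnion (sample n x) = (sampledIn N R).biUnion fun r => (x r).genes := by
  ext u
  simp only [Finset.mem_biUnion, sampledIn, Finset.mem_filter, Finset.mem_univ, true_and, sample]
  constructor
  · rintro ⟨s, hs, hu⟩
    split_ifs at hu with h
    · exact ⟨⟨s, h⟩, ⟨s, hs, rfl⟩, hu⟩
    · simp at hu
  · rintro ⟨r, ⟨s, hs, hsr⟩, hu⟩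
    have h : (s : ℕ) < N := hsr ▸ r.2
    refine ⟨s, hs, ?_⟩
    rw [dif_pos h]
    convert hu

lemma card_sampledIn (h : n ≤ N) (R : Finset (Fin n)) : (sampledIn N R).card = R.card := by
  have : sampledIn N R = R.map (Fin.castLEEmb h) := by
    ext r
    simp [sampledIn, Fin.ext_iff]
  rw [this, Finset.card_map]

lemma privateGenes_eq_carrierSum (x : Population N) {i : Fin n} (hi : (i : ℕ) < N)
    (R : Finset (Fin n)) :
    privateGenes x i R = carrierSum
      (fun S => if ⟨i, hi⟩ ∈ S ∧ Disjoint S (sampledIn N R) then 1 else 0) x := by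
  rw [← card_sdiff_biUnion_eq_carrierSum, privateGenes, biUnion_sample]
  simp [sample, hi]

/-- Padded individuals occur because integrability is claimed for every N, including N < n. -/
lemma privateGenes_eq_zero (x : Population N) {i : Fin n} (hi : ¬ (i : ℕ) < N)
    (R : Finset (Fin n)) : privateGenes x i R = 0 := by
  simp [privateGenes, sample, hi]

lemma averageGenes_sample (x : Population N) :
    averageGenes (sample n x) = (1 / (n : ℝ)) * ∑ i : Fin n, privateGenes x i ∅ := by
  simp [averageGenes, privateGenes]

lemma pairwiseDifferences_sample (x : Population N) :
    pairwiseDifferences (sample n x) = (1 / ((n : ℝ) * ((n : ℝ) - 1))) *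
      ∑ i : Fin n, ∑ j ∈ Finset.univ.filter (fun j => j ≠ i), privateGenes x i {j} := by
  simp [pairwiseDifferences, privateGenes]

/-- Each gene of the sample is counted once, at its carrier of smallest index. -/
lemma accessoryGenomeSize_sample (x : Population N) :
    accessoryGenomeSize (sample n x) = ∑ i : Fin n, privateGenes x i (Finset.Iio i) := by
  set g := sample n x
  have hU : Finset.univ.biUnion g =
      Finset.univ.biUnion fun i => g i \ (Finset.Iio i).biUnion g := by
    ext u
    simp only [Finset.mem_biUnion, Finset.mem_univ, true_and, Finset.mem_sdiff, Finset.mem_Iio]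
    constructor
    · intro h
      obtain ⟨i, hi, hmin⟩ := WellFounded.has_min (wellFounded_lt (α := Fin n))
        {i | u ∈ g i} h
      exact ⟨i, hi, fun ⟨j, hj, hu⟩ => hmin j hu hj⟩
    · rintro ⟨i, hi, -⟩
      exact ⟨i, hi⟩
  unfold accessoryGenomeSize privateGenes
  rw [hU, Finset.card_biUnion, Nat.cast_sum]
  have key {i j : Fin n} (hij : i < j) :
      Disjoint (g i \ (Finset.Iio i).biUnion g) (g j \ (Finset.Iio j).biUnion g) := by
    rw [Finset.disjoint_left]
    intro u hu hu'
    exact (Finset.mem_sdiff.1 hu').2 (Finset.mem_biUnion.2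
      ⟨i, Finset.mem_Iio.2 hij, (Finset.mem_sdiff.1 hu).1⟩)
  intro i _ j _ hij
  rcases lt_or_gt_of_ne hij with h | h
  · exact key h
  · exact (key h).symm

variable {θ ρ γ : ℝ}

lemma integrable_privateGenes {Ω : Type*} [MeasurableSpace Ω] {P : Measure Ω}
    [IsProbabilityMeasure P] {X : ℝ≥0 → Ω → Population N} (hθ : 0 < θ) (hρ : 0 < ρ) (hγ : 0 ≤ γ)
    (hX : IsMoranModel θ ρ γ P X) (hEq : IsInEquilibrium P X) (i : Fin n) (R : Finset (Fin n)) :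
    Integrable (fun ω => privateGenes (X 0 ω) i R) P := by
  by_cases hi : (i : ℕ) < N
  · simp_rw [privateGenes_eq_carrierSum _ hi]
    exact integrable_carrierSum hθ hρ hγ hX hEq _
  · simp_rw [privateGenes_eq_zero _ hi]
    exact integrable_zero _ _ _

lemma integral_privateGenes {Ω : Type*} [MeasurableSpace Ω] {P : Measure Ω}
    [IsProbabilityMeasure P] {X : ℝ≥0 → Ω → Population N} (hθ : 0 < θ) (hρ : 0 < ρ) (hγ : 0 ≤ γ)
    (hX : IsMoranModel θ ρ γ P X) (hEq : IsInEquilibrium P X) (hnN : n ≤ N) {i : Fin n}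
    {R : Finset (Fin n)} (hi : i ∉ R) :
    ∫ ω, privateGenes (X 0 ω) i R ∂P = ∑ k ∈ Finset.range (N - 1 - R.card + 1),
      ((N - 1 - R.card).choose k : ℝ) * carrierWeight θ ρ γ N (k + 1) := by
  have hiN : (i : ℕ) < N := i.2.trans_le hnN
  have hR : R.card < n := by
    have := Finset.card_lt_univ_of_notMem hi
    rwa [Fintype.card_fin] at this
  simp_rw [privateGenes_eq_carrierSum _ hiN]
  rw [integral_carrierSum hθ hρ hγ hX hEq (by simp), sum_ite_mem_disjoint]
  · simp only [sampledIn, Finset.mem_filter, Finset.mem_univ, true_and, not_exists, not_and]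
    intro s hs hsi
    exact hi (Fin.ext hsi ▸ hs)
  · rw [card_sampledIn hnN]
    omega

lemma tendsto_integral_privateGenes {Ω : ℕ → Type*} [∀ N, MeasurableSpace (Ω N)]
    {P : ∀ N, Measure (Ω N)} [∀ N, IsProbabilityMeasure (P N)]
    {X : ∀ N, ℝ≥0 → Ω N → Population N} (hθ : 0 < θ) (hρ : 0 < ρ) (hγ : 0 ≤ γ)
    (hX : ∀ N, IsMoranModel θ ρ γ (P N) (X N)) (hEq : ∀ N, IsInEquilibrium (P N) (X N))
    {i : Fin n} {R : Finset (Fin n)} (hi : i ∉ R) :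
    Tendsto (fun N => ∫ ω, privateGenes (X N 0 ω) i R ∂(P N)) atTop
      (𝓝 (θ * ∑' m : ℕ, γ ^ m / rising (ρ + R.card) (m + 1))) := by
  refine (tendsto_sum_choose_mul_carrierWeight θ hρ hγ R.card).congr' ?_
  filter_upwards [eventually_ge_atTop n] with N hN
  exact (integral_privateGenes hθ hρ hγ (hX N) (hEq N) hN hi).symm

end Sample

end InfinitelyManyGenes

end

open InfinitelyManyGenes in
theorem theorem2 (θ ρ γ : ℝ) (hθ : 0 < θ) (hρ : 0 < ρ) (hγ : 0 ≤ γ) (n : ℕ) (hn : 1 ≤ n)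
    (Ω : ℕ → Type*) [∀ N, MeasurableSpace (Ω N)]
    (P : ∀ N, Measure (Ω N)) [∀ N, IsProbabilityMeasure (P N)]
    (X : ∀ N, ℝ≥0 → Ω N → Population N)
    (hX : ∀ N, IsMoranModel θ ρ γ (P N) (X N))
    (hEq : ∀ N, IsInEquilibrium (P N) (X N)) :
    ((∀ N, Integrable (fun ω => averageGenes (sample n (X N 0 ω))) (P N)) ∧
      Summable (fun m : ℕ => γ ^ (m + 1) / rising (1 + ρ) (m + 1)) ∧
      Tendsto (fun N => ∫ ω, averageGenes (sample n (X N 0 ω)) ∂(P N)) atTop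
        (𝓝 (θ / ρ * (1 + ∑' m : ℕ, γ ^ (m + 1) / rising (1 + ρ) (m + 1))))) ∧
    (2 ≤ n →
      (∀ N, Integrable (fun ω => pairwiseDifferences (sample n (X N 0 ω))) (P N)) ∧
      Summable (fun m : ℕ => γ ^ (m + 1) / rising (2 + ρ) (m + 1)) ∧
      Tendsto (fun N => ∫ ω, pairwiseDifferences (sample n (X N 0 ω)) ∂(P N)) atTop
        (𝓝 (θ / (1 + ρ) * (1 + ∑' m : ℕ, γ ^ (m + 1) / rising (2 + ρ) (m + 1))))) ∧
    ((∀ N, Integrable (fun ω => accessoryGenomeSize (sample n (X N 0 ω))) (P N)) ∧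
      Summable (fun m : ℕ => γ ^ (m + 1) / ((m + 1 : ℕ) : ℝ) *
        (1 / rising ρ (m + 1) - 1 / rising (n + ρ) (m + 1))) ∧
      Tendsto (fun N => ∫ ω, accessoryGenomeSize (sample n (X N 0 ω)) ∂(P N)) atTop
        (𝓝 (θ * ∑ k ∈ Finset.range n, 1 / ((k : ℝ) + ρ) +
          θ * ∑' m : ℕ, γ ^ (m + 1) / ((m + 1 : ℕ) : ℝ) *
            (1 / rising ρ (m + 1) - 1 / rising (n + ρ) (m + 1))))) := by
  have hint (N : ℕ) (i : Fin n) (R : Finset (Fin n)) :=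
    integrable_privateGenes hθ hρ hγ (hX N) (hEq N) i R
  have hlim {i : Fin n} {R : Finset (Fin n)} (hi : i ∉ R) :=
    tendsto_integral_privateGenes hθ hρ hγ hX hEq hi
  have hn0 : (n : ℝ) ≠ 0 := by positivity
  refine ⟨⟨fun N => ?_, summable_pow_succ_div_rising (by positivity) hγ, ?_⟩,
    fun hn2 => ⟨fun N => ?_, summable_pow_succ_div_rising (by positivity) hγ, ?_⟩,
    fun N => ?_, summable_pow_div_mul_sub_inv_rising hρ hγ n, ?_⟩
  · simp_rw [averageGenes_sample]
    exact (integrable_finsetSum _ fun i _ => hint N i ∅).const_mul _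
  · simp_rw [averageGenes_sample, integral_const_mul,
      fun N => integral_finsetSum Finset.univ fun i _ => hint N i ∅]
    have h := (tendsto_finsetSum Finset.univ fun (i : Fin n) _ =>
      hlim (Finset.notMem_empty i)).const_mul (1 / (n : ℝ))
    convert h using 2
    rw [Finset.card_empty, Nat.cast_zero, add_zero, tsum_pow_div_rising hρ hγ, Finset.sum_const,
      Finset.card_univ, Fintype.card_fin, nsmul_eq_mul]
    field_simp
  · simp_rw [pairwiseDifferences_sample]
    exact (integrable_finsetSum _ fun i _ => integrable_finsetSum _ fun j _ =>
      hint N i {j}).const_mul _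
  · simp_rw [pairwiseDifferences_sample, integral_const_mul,
      fun N => integral_finsetSum Finset.univ fun i _ => integrable_finsetSum
        (Finset.univ.filter fun j => j ≠ i) fun j _ => hint N i {j},
      fun N (i : Fin n) => integral_finsetSum (Finset.univ.filter fun j => j ≠ i)
        fun j _ => hint N i {j}]
    have h := (tendsto_finsetSum Finset.univ fun (i : Fin n) _ =>
      tendsto_finsetSum (Finset.univ.filter fun j => j ≠ i) fun j hj =>
        hlim (R := {j}) (i := i) (by simpa [eq_comm] using hj)).const_mul
          (1 / ((n : ℝ) * ((n : ℝ) - 1)))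
    convert h using 2
    have hn1 : (n : ℝ) - 1 ≠ 0 := by
      have : (2 : ℝ) ≤ n := by exact_mod_cast hn2
      linarith
    have hcard (i : Fin n) : ((Finset.univ.filter fun j => j ≠ i).card : ℝ) = (n : ℝ) - 1 := by
      rw [Finset.filter_ne', Finset.card_erase_of_mem (Finset.mem_univ i), Finset.card_univ,
        Fintype.card_fin, Nat.cast_sub hn, Nat.cast_one]
    simp_rw [Finset.card_singleton, Nat.cast_one, Finset.sum_const, nsmul_eq_mul, hcard,
      Finset.sum_const, nsmul_eq_mul, Finset.card_univ, Fintype.card_fin]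
    rw [tsum_pow_div_rising (by positivity : 0 < ρ + 1) hγ,
      show 1 + (ρ + 1) = 2 + ρ by ring, add_comm 1 ρ]
    field_simp
  · simp_rw [accessoryGenomeSize_sample]
    exact integrable_finsetSum _ fun i _ => hint N i _
  · simp_rw [accessoryGenomeSize_sample,
      fun N => integral_finsetSum Finset.univ fun i _ => hint N i (Finset.Iio i)]
    have h := tendsto_finsetSum Finset.univ fun (i : Fin n) _ =>
      hlim (i := i) (R := Finset.Iio i) (by simp)
    convert h using 2
    -- Individual `i` has exactly `i` predecessors, so the limits have l = 0, …, n - 1.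
    simp_rw [Fin.card_Iio]
    rw [Fin.sum_univ_eq_sum_range (fun l => θ * ∑' m : ℕ, γ ^ m / rising (ρ + l) (m + 1)),
      ← Finset.mul_sum, sum_tsum_pow_div_rising hρ hγ, mul_add]
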